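/- **Setting.** A hierarchical network has levels $k=1,\dots,m$ ($m\ge 1$). Level $k$ is a finite directed graph whose edge set is a disjoint union $E^k=\tilde E^k\sqcup\bar E^k$ of ordinary and nested edges, with $\bar E^m=\varnothing$. $OD^1$ is a finite set of source–sink pairs with demands $d^1_w>0$, and for $k<m$ the nested edges of level $k$ are the source–sink pairs of level $k+1$: $OD^{k+1}=\bar E^k$. Each $w\in OD^k$ is served by a finite nonempty set $P^k_w$ of paths in the graph of level $k$ from the source to the sink of $w$ (for example, all simple ones), and every edge of level $k$ lies on at least one path of $P^k=\bigsqcup_{w\in OD^k}P^k_w$. Put $\delta_{ep}=1$ if $e\in p$, and $\delta_{ep}=0$ otherwise. Let $E=\bigsqcup_{k}\tilde E^k$. Each $e\in E$ has a continuous nondecreasing cost function $\tau_e:[0,\infty)\to[0,\infty)$; put $\sigma_e(f)=\int_0^f\tau_e(z)\,dz$. Let $\gamma^1,\dots,\gamma^m>0$. **Primal problem.** For path flows $x=(x^k_p)$ let $f=\Theta x$, i.e. $f^k_e=\sum_{p\in P^k}\delta_{ep}x^k_p$ for $e\in E^k$, and $d^{k+1}_e=f^k_e$ for $e\in\bar E^k=OD^{k+1}$.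 The set $X$ consists of the $x\ge 0$ with $\sum_{p\in P^k_w}x^k_p=d^k_w$ for all $k$ and $w\in OD^k$. With $0\ln 0=0\ln(0/0)=0$ put $$\Psi(x,f)=\sum_{k=1}^m\Bigl[\sum_{e\in\tilde E^k}\sigma_e(f^k_e)+\gamma^k\sum_{w\in OD^k}\sum_{p\in P^k_w}x^k_p\ln(x^k_p/d^k_w)\Bigr].$$ The joint problem is $\min\{\Psi(x,f): f=\Theta x,\ x\in X\}$. The nested problem is the chain $(\Phi^{m+1}=0)$ $$\Phi^k(d^k)=\min_{x^k}\Bigl\{\sum_{e\in\tilde E^k}\sigma_e(f^k_e)+\Phi^{k+1}(d^{k+1})+\gamma^k\sum_{w\in OD^k}\sum_{p\in P^k_w}x^k_p\ln(x^k_p/d^k_w)\Bigr\},$$ the minimum being over $x^k\ge0$ with $\sum_{p\in P^k_w}x^k_p=d^k_w$ for $w\in OD^k$, and with $f^k$ and $d^{k+1}_e=f^k_e$ $(e\in\bar E^k)$ determined by $x^k$. A solution of it is an $x=(x^1,\dots,x^m)$ such that each $x^k$ solves the $k$-th problem for the $d^k$ determined by $x^{k-1}$ ($d^1$ being given). **Dual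 problem.** For $e\in E$ let $\sigma^*_e(s)=\sup_{f\ge0}\{fs-\sigma_e(f)\}$, and let $\operatorname{dom}\sigma^*$ be the set of $t\in\mathbb R^E$ with $\sigma_e^*(t_e)<\infty$ for all $e$. Define, from $k=m$ down to $k=1$, $$g^k_p(t)=\sum_{e\in\tilde E^k}\delta_{ep}t_e-\sum_{e\in\bar E^k}\delta_{ep}\,\gamma^{k+1}\psi^{k+1}_e(t/\gamma^{k+1}),\qquad \psi^k_w(t/\gamma^k)=\ln\sum_{p\in P^k_w}\exp\bigl(-g^k_p(t)/\gamma^k\bigr),$$ i.e. $\psi^k_w(s)=\ln\sum_{p\in P^k_w}\exp(-g^k_p(\gamma^ks)/\gamma^k)$, and $\psi^1(s)=\sum_{w\in OD^1}d^1_w\psi^1_w(s)$. The dual problem is to minimize $D(t)=\gamma^1\psi^1(t/\gamma^1)+\sum_{e\in E}\sigma_e^*(t_e)$ over $t\in\operatorname{dom}\sigma^*$. **Theorem.** 1. Strong duality holds, both minima being attained: $$\min\{\Psi(x,f): f=\Theta x,\ x\in X\}=-\min_{t\in\operatorname{dom}\sigma^*}\Bigl\{\gamma^1\psi^1(t/\gamma^1)+\sum_{e\in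 E}\sigma_e^*(t_e)\Bigr\}.$$ 2. The dual problem has exactly one solution $t$, and $t\ge0$. The joint and the nested primal problem each have exactly one solution, and it is the same $x$ for both. It is recovered from $t$: the function $\psi^1$ is differentiable at $t/\gamma^1$, the flows $f=\Theta x$ on the ordinary edges are $$(f_e)_{e\in E}=-\nabla\psi^1(t/\gamma^1),$$ and $x$ is the only vector of path flows such that $$x^k_p=d^k_w\,\frac{\exp(-g^k_p(t)/\gamma^k)}{\sum_{q\in P^k_w}\exp(-g^k_q(t)/\gamma^k)},\qquad p\in P^k_w,\ w\in OD^k,\ k=1,\dots,m,$$ where $d^{k+1}_e=f^k_e$ for $e\in\bar E^k$. 3. Conversely, if $f=\Theta x$ is the solution of the primal problem, then $t=(\tau_e(f_e))_{e\in E}$ is the unique solution of the dual problem. 4. If some of the parameters $\gamma^k$ are replaced by $0$, then the vector $(\tau_e(f_e))_{e\in E}$ is still the same for all solutions of the joint primal problem (which may then be non-unique). -/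

import Mathlib

/-- `p` (a nonempty list of consecutive directed edges, all from `E`) leads from `a` to `b`. -/
def IsEdgePath {V : Type*} (E : Finset (V × V)) (a b : V) (p : List (V × V)) : Prop :=
  p ≠ [] ∧ (∀ e ∈ p, e ∈ E) ∧ p.IsChain (fun e e' => e.2 = e'.1) ∧
    p.head?.map Prod.fst = some a ∧ p.getLast?.map Prod.snd = some b

/-- A hierarchical transport network with `m ≥ 1` levels.  Levels are numbered `0, …, m - 1`
(the usual numbering is `1, …, m`).  All the graphs have their vertices in the ambient type `V`.

The edge set of the graph of level `k` is the disjoint union of the set `ordinary k` of ordinary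
edges (those that carry cost functions) and of the set of nested edges; the vertex pairs which are
the nested edges of level `k` are the source-sink pairs of level `k + 1`, so the set of nested
edges of level `k` is `OD (k + 1)`.  The last level has no nested edges. -/
structure MultilevelNetwork (V : Type*) [DecidableEq V] where
  /-- number of levels -/
  m : ℕ
  m_pos : 0 < m
  /-- ordinary edges of a level -/
  ordinary : Fin m → Finset (V × V)
  /-- source-sink pairs of a level; `OD (k + 1)` is also the set of nested edges of level `k` -/
  OD : ℕ → Finset (V × V)
  OD_last : OD m = ∅
  disjoint_edges : ∀ k : Fin m, Disjoint (ordinary k) (OD (k + 1))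
  /-- the finite set of paths of level `k` that serve the source-sink pair `w`
  (for instance all the simple ones) -/
  paths : Fin m → V × V → Finset (List (V × V))
  paths_nonempty : ∀ k : Fin m, ∀ w ∈ OD k, (paths k w).Nonempty
  paths_isPath : ∀ k : Fin m, ∀ w ∈ OD k, ∀ p ∈ paths k w,
    IsEdgePath (ordinary k ∪ OD (k + 1)) w.1 w.2 p
  /-- there are no superfluous edges: every edge lies on a path -/
  edge_used : ∀ k : Fin m, ∀ e ∈ ordinary k ∪ OD (k + 1), ∃ w ∈ OD k, ∃ p ∈ paths k w, e ∈ p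

namespace MultilevelNetwork

variable {V : Type*} [DecidableEq V] (N : MultilevelNetwork V)

/-- The top level. -/
def top : Fin N.m := ⟨0, N.m_pos⟩

/-- All ordinary edges of all levels (disjoint union over the levels). -/
abbrev Edge : Type _ := Σ k : Fin N.m, {e : V × V // e ∈ N.ordinary k}

/-- Real vectors indexed by the paths of level `k`. -/
abbrev LevelFlow (k : Fin N.m) : Type _ :=
  (w : {w : V × V // w ∈ N.OD k}) → {p : List (V × V) // p ∈ N.paths k w} → ℝ

/-- Real vectors indexed by the paths of all levels. -/
abbrev PathFlow : Type _ := (k : Fin N.m) → N.LevelFlow k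

/-! ### The primal problem -/

/-- The flow on the edge `e` of level `k` generated by the path flows `y`: the `e`-th coordinate
of the product of the edge-path incidence matrix and `y`. -/
def edgeFlow {k : Fin N.m} (y : N.LevelFlow k) (e : V × V) : ℝ :=
  ∑ w : {w : V × V // w ∈ N.OD k}, ∑ p : {p : List (V × V) // p ∈ N.paths k w},
    if e ∈ p.1 then y w p else 0

/-- The vector of flows on the ordinary edges of all levels generated by the path flows `x`. -/
noncomputable def flowVec (x : N.PathFlow) : EuclideanSpace ℝ N.Edge :=
  WithLp.toLp 2 fun e => N.edgeFlow (x e.1) e.2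

/-- The demands of level `k`: given by `d` on the top level, and by the flows on the nested edges
of the previous level otherwise. -/
def demand (d : V × V → ℝ) (x : N.PathFlow) : Fin N.m → V × V → ℝ
  | ⟨0, _⟩ => d
  | ⟨j + 1, h⟩ => N.edgeFlow (x ⟨j, Nat.lt_of_succ_lt h⟩)

/-- The path flows `y` of level `k` are nonnegative and meet the demands `d`. -/
def IsLevelFeasible (k : Fin N.m) (d : V × V → ℝ) (y : N.LevelFlow k) : Prop :=
  (∀ w p, 0 ≤ y w p) ∧ ∀ w, ∑ p, y w p = d w

/-- The path flows of all levels are feasible, the demands of the top level being `d`. -/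
def IsFeasible (d : V × V → ℝ) (x : N.PathFlow) : Prop :=
  ∀ k, N.IsLevelFeasible k (N.demand d x k) (x k)

end MultilevelNetwork

/-- `σ(f) = ∫₀ᶠ τ(z) dz`. -/
noncomputable def costIntegral (c : ℝ → ℝ) (f : ℝ) : ℝ := ∫ z in (0 : ℝ)..f, c z

namespace MultilevelNetwork

variable {V : Type*} [DecidableEq V] (N : MultilevelNetwork V)

/-- The contribution of level `k` to the primal objective, the demands of the level being `d`. -/
noncomputable def levelCost (γ : Fin N.m → ℝ) (τ : N.Edge → ℝ → ℝ) (k : Fin N.m)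
    (d : V × V → ℝ) (y : N.LevelFlow k) : ℝ :=
  ∑ e : {e : V × V // e ∈ N.ordinary k}, costIntegral (τ ⟨k, e⟩) (N.edgeFlow y e) +
    γ k * ∑ w, ∑ p, y w p * Real.log (y w p / d w)

/-- The primal objective: the sum of the contributions of all levels. -/
noncomputable def primalObjective (d : V × V → ℝ) (γ : Fin N.m → ℝ) (τ : N.Edge → ℝ → ℝ)
    (x : N.PathFlow) : ℝ :=
  ∑ k, N.levelCost γ τ k (N.demand d x k) (x k)

/-- `x` solves the primal problem, all levels being optimized jointly. -/
def IsPrimalSolution (d : V × V → ℝ) (γ : Fin N.m → ℝ) (τ : N.Edge → ℝ → ℝ)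
    (x : N.PathFlow) : Prop :=
  N.IsFeasible d x ∧ ∀ y, N.IsFeasible d y →
    N.primalObjective d γ τ x ≤ N.primalObjective d γ τ y

/-- The optimal value of the chain of nested problems that starts with level `k`, the demands of
this level being `d`; it is `0` when there are no levels left (`k ≥ m`). -/
noncomputable def nestedValue (γ : Fin N.m → ℝ) (τ : N.Edge → ℝ → ℝ) (k : ℕ)
    (d : V × V → ℝ) : ℝ :=
  if h : k < N.m then
    sInf {v | ∃ y : N.LevelFlow ⟨k, h⟩, N.IsLevelFeasible ⟨k, h⟩ d y ∧
      v = N.levelCost γ τ ⟨k, h⟩ d y + nestedValue γ τ (k + 1) (N.edgeFlow y)}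
  else 0
termination_by N.m - k

/-- `x` solves the chain of nested problems: on every level it solves the problem of that level,
whose demands are determined by the flows of the previous level and whose objective contains the
optimal value of the remaining levels. -/
def IsNestedSolution (d : V × V → ℝ) (γ : Fin N.m → ℝ) (τ : N.Edge → ℝ → ℝ)
    (x : N.PathFlow) : Prop :=
  ∀ k : Fin N.m, N.IsLevelFeasible k (N.demand d x k) (x k) ∧
    ∀ y : N.LevelFlow k, N.IsLevelFeasible k (N.demand d x k) y →
      N.levelCost γ τ k (N.demand d x k) (x k) + N.nestedValue γ τ (k + 1) (N.edgeFlow (x k)) ≤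
        N.levelCost γ τ k (N.demand d x k) y + N.nestedValue γ τ (k + 1) (N.edgeFlow y)

/-! ### The dual problem -/

mutual

/-- The cost `g` of the path `p` of level `k` at the edge costs `t`: the costs of the ordinary
edges of the path, and the averaged costs `-γ ψ(t / γ)` of its nested edges. -/
noncomputable def pathCost (γ : Fin N.m → ℝ) (k : Fin N.m) (p : List (V × V))
    (t : EuclideanSpace ℝ N.Edge) : ℝ :=
  (∑ e : {e : V × V // e ∈ N.ordinary k}, if e.1 ∈ p then t ⟨k, e⟩ else 0) -
    if h : (k : ℕ) + 1 < N.m then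
      ∑ e ∈ N.OD (k + 1), if e ∈ p then
        γ ⟨k + 1, h⟩ * pairPsi γ ⟨k + 1, h⟩ e ((γ ⟨k + 1, h⟩)⁻¹ • t) else 0
    else 0
termination_by (N.m - k, 0)

/-- The function `ψ` of the source-sink pair `w` of level `k`, normalized so that
`ψ(t / γ) = log ∑ₚ exp(-gₚ(t) / γ)`, where `γ` is the parameter of the level. -/
noncomputable def pairPsi (γ : Fin N.m → ℝ) (k : Fin N.m) (w : V × V)
    (s : EuclideanSpace ℝ N.Edge) : ℝ :=
  Real.log (∑ p ∈ N.paths k w, Real.exp (-pathCost γ k p (γ k • s) / γ k))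
termination_by (N.m - k, 1)

end

/-- The function `ψ` of the top level, a sum over its source-sink pairs. -/
noncomputable def psi (d : V × V → ℝ) (γ : Fin N.m → ℝ) (s : EuclideanSpace ℝ N.Edge) : ℝ :=
  ∑ w ∈ N.OD 0, d w * N.pairPsi γ N.top w s

end MultilevelNetwork

/-- The domain of the conjugate of `σ(f) = ∫₀ᶠ τ(z) dz`, `f ≥ 0`. -/
def conjugateDomain (c : ℝ → ℝ) : Set ℝ :=
  {s | BddAbove ((fun f => f * s - costIntegral c f) '' Set.Ici 0)}

/-- The conjugate `σ*(s) = sup_{f ≥ 0} (f s - σ(f))` (a finite supremum for `s` in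
`conjugateDomain c`). -/
noncomputable def conjugate (c : ℝ → ℝ) (s : ℝ) : ℝ :=
  sSup ((fun f => f * s - costIntegral c f) '' Set.Ici 0)

namespace MultilevelNetwork

variable {V : Type*} [DecidableEq V] (N : MultilevelNetwork V)

/-- The domain of the dual problem. -/
def dualDomain (τ : N.Edge → ℝ → ℝ) : Set (EuclideanSpace ℝ N.Edge) :=
  {t | ∀ e, t e ∈ conjugateDomain (τ e)}

/-- The dual objective. -/
noncomputable def dualObjective (d : V × V → ℝ) (γ : Fin N.m → ℝ) (τ : N.Edge → ℝ → ℝ)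
    (t : EuclideanSpace ℝ N.Edge) : ℝ :=
  γ N.top * N.psi d γ ((γ N.top)⁻¹ • t) + ∑ e, conjugate (τ e) (t e)

/-- `t` solves the dual problem. -/
def IsDualSolution (d : V × V → ℝ) (γ : Fin N.m → ℝ) (τ : N.Edge → ℝ → ℝ)
    (t : EuclideanSpace ℝ N.Edge) : Prop :=
  t ∈ N.dualDomain τ ∧ ∀ s ∈ N.dualDomain τ, N.dualObjective d γ τ t ≤ N.dualObjective d γ τ s

/-- The path flows `x` are the logit (Gibbs) distributions at the edge costs `t`, on every level
with the demands that are determined by the previous level. -/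
def IsGibbsFlow (d : V × V → ℝ) (γ : Fin N.m → ℝ) (t : EuclideanSpace ℝ N.Edge)
    (x : N.PathFlow) : Prop :=
  ∀ k w p, x k w p = N.demand d x k w *
    (Real.exp (-N.pathCost γ k p t / γ k) /
      ∑ q ∈ N.paths k w, Real.exp (-N.pathCost γ k q t / γ k))

end MultilevelNetwork

open Filter Topology

/-! ### Elementary inequalities -/

-- For fixed edge costs `t`, the Gibbs variational principle on one level bounds path cost plus
-- entropy below by the potentials `-γ ψ(t / γ)` weighted with the demands, with equality exactly at
-- the logit distribution. The averaged costs of nested edges are these potentials one level down,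
-- and the demands there are the flows on those edges, so the sum over levels telescopes
-- (`sum_level_gap`). What is left is `0 ≤ ⟨t, f⟩ + entropy + γ¹ψ¹(t / γ¹)`, with equality iff `x`
-- is the Gibbs flow at `t`.
--
-- Adding Fenchel–Young on every edge gives weak duality. A pair without gap is tight in both
-- inequalities: `x` is Gibbs at `t`, hence positive on every edge, and therefore `t = τ(f)`. This
-- yields uniqueness on both sides.
--
-- A pair without gap exists: compactness gives a primal minimizer `x`, and its variational
-- inequality, in which only the cost integrals are linearized, compares it with the Gibbs flow at
-- `t = τ(f)` and forces `x` to be that flow. The same inequality, written for two minimizers and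
-- added, gives the claim about vanishing parameters.
--
-- The gradient formula holds because `t / γ¹` minimizes `ψ¹ + ⟨f, ·⟩`. For the nested problem, the
-- dual bound restricted to the levels from `k` on obeys the recursion of `nestedValue` as an
-- inequality, and the Gibbs flow attains it on each level.

theorem mul_log_div_sub {x d z : ℝ} (hx : 0 < x) (hd : 0 < d) (hz : 0 < z) :
    x * Real.log (x / d) - (x * Real.log z + x - d * z) =
      x * (d * z / x - 1 - Real.log (d * z / x)) := by
  rw [Real.log_div hx.ne' hd.ne', Real.log_div (by positivity) hx.ne',
    Real.log_mul hd.ne' hz.ne']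
  field_simp
  ring

/-- Tangent inequality for `x ↦ x log (x / d)`. -/
theorem tangent_le_mul_log_div {x d z : ℝ} (hx : 0 ≤ x) (hxd : x ≤ d) (hz : 0 < z) :
    0 ≤ x * Real.log (x / d) - (x * Real.log z + x - d * z) := by
  rcases hx.eq_or_lt with rfl | hx
  · simpa using mul_nonneg hxd hz.le
  · have hd := hx.trans_le hxd
    rw [mul_log_div_sub hx hd hz]
    have := Real.log_le_sub_one_of_pos (show 0 < d * z / x by positivity)
    exact mul_nonneg hx.le (by linarith)

/-- Strictness of `log u < u - 1` away from `u = 1`, used at `u = d z / x`. For `x = 0` the gap is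
`d z` itself. -/
theorem tangent_eq_mul_log_div_iff {x d z : ℝ} (hx : 0 ≤ x) (hxd : x ≤ d) (hz : 0 < z) :
    x * Real.log (x / d) - (x * Real.log z + x - d * z) = 0 ↔ x = d * z := by
  rcases hx.eq_or_lt with rfl | hx
  · simp [eq_comm]
  · have hd := hx.trans_le hxd
    rw [mul_log_div_sub hx hd hz]
    have hu : 0 < d * z / x := by positivity
    constructor
    · intro h
      by_contra hne
      have h1 : d * z / x ≠ 1 := fun h1 => hne ((div_eq_one_iff_eq hx.ne').1 h1).symm
      have := Real.log_lt_sub_one_of_pos hu h1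
      exact absurd h (mul_pos hx (by linarith)).ne'
    · intro h
      rw [← h, div_self hx.ne']
      simp

/-- Joint convexity of `(x, d) ↦ x log (x / d)`. -/
theorem convex_mul_log_div {x d x' d' a b : ℝ} (hx : 0 ≤ x) (hxd : x ≤ d) (hx' : 0 ≤ x')
    (hxd' : x' ≤ d') (ha : 0 < a) (hb : 0 < b) :
    (a * x + b * x') * Real.log ((a * x + b * x') / (a * d + b * d')) ≤
      a * (x * Real.log (x / d)) + b * (x' * Real.log (x' / d')) := by
  have hs : 0 ≤ a * x + b * x' := by positivity
  rcases hs.eq_or_lt with h0 | hs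
  · have h1 : x = 0 := by
      have : 0 ≤ b * x' := by positivity
      have h : a * x = 0 := le_antisymm (by linarith) (by positivity)
      exact (mul_eq_zero.1 h).resolve_left ha.ne'
    have h2 : x' = 0 := by
      rw [h1, mul_zero, zero_add] at h0
      exact (mul_eq_zero.1 h0.symm).resolve_left hb.ne'
    simp [h1, h2]
  · have hsd : a * x + b * x' ≤ a * d + b * d' := by gcongr
    have hD := hs.trans_le hsd
    -- The slope is the ratio at the combined point, where the tangent is exact. Both tangent
    -- inequalities use this same `z`, so they add up.
    set z := (a * x + b * x') / (a * d + b * d') with hz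
    have hzp : 0 < z := by positivity
    have e1 := mul_nonneg ha.le (tangent_le_mul_log_div hx hxd hzp)
    have e2 := mul_nonneg hb.le (tangent_le_mul_log_div hx' hxd' hzp)
    have e3 : (a * d + b * d') * z = a * x + b * x' := by
      rw [hz]; field_simp
    nlinarith

/-- After splitting the logarithm, the only delicate point is the origin, where `x ≤ d` lets `d log
d → 0` dominate `x log d`. -/
theorem continuousOn_mul_log_div :
    ContinuousOn (fun q : ℝ × ℝ => q.1 * Real.log (q.1 / q.2)) {q | 0 ≤ q.1 ∧ q.1 ≤ q.2} := by
  have h1 : ContinuousOn (fun q : ℝ × ℝ => q.1 * Real.log q.1 - q.1 * Real.log q.2)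
      {q | 0 ≤ q.1 ∧ q.1 ≤ q.2} := by
    refine ContinuousOn.sub
      (Real.continuous_mul_log.comp continuous_fst).continuousOn ?_
    rintro ⟨x, d⟩ ⟨hx, hxd⟩
    rcases (hx.trans hxd).eq_or_lt with h0 | h0
    · simp only at h0 hx hxd
      obtain rfl : x = 0 := by linarith
      subst h0
      have h2 : Tendsto (fun q : ℝ × ℝ => |q.2 * Real.log q.2|)
          (𝓝[{q | 0 ≤ q.1 ∧ q.1 ≤ q.2}] ((0 : ℝ), (0 : ℝ))) (𝓝 0) := by
        have : Continuous fun q : ℝ × ℝ => |q.2 * Real.log q.2| :=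
          (Real.continuous_mul_log.comp continuous_snd).abs
        simpa using (this.tendsto ((0 : ℝ), (0 : ℝ))).mono_left nhdsWithin_le_nhds
      unfold ContinuousWithinAt
      simp only [zero_mul]
      refine squeeze_zero_norm' ?_ h2
      filter_upwards [self_mem_nhdsWithin] with q hq
      rw [Real.norm_eq_abs, abs_mul, abs_mul, abs_of_nonneg hq.1,
        abs_of_nonneg (hq.1.trans hq.2)]
      exact mul_le_mul_of_nonneg_right hq.2 (abs_nonneg _)
    · exact (continuousAt_fst.mul (continuousAt_snd.log h0.ne')).continuousWithinAt
  refine h1.congr ?_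
  rintro ⟨x, d⟩ ⟨hx, hxd⟩
  simp only at hx hxd ⊢
  rcases hx.eq_or_lt with rfl | hx
  · simp
  · rw [Real.log_div hx.ne' (hx.trans_le hxd).ne', mul_sub]

/-- The gap in the Gibbs variational principle. -/
theorem gibbs_gap {ι : Type*} [Fintype ι] [Nonempty ι] (g y : ι → ℝ) {D γ : ℝ} (hγ : 0 < γ)
    (hD : ∑ p, y p = D) :
    ∑ p, y p * g p + γ * ∑ p, y p * Real.log (y p / D) +
        D * (γ * Real.log (∑ p, Real.exp (-g p / γ))) =
      γ * ∑ p, (y p * Real.log (y p / D) -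
        (y p * Real.log (Real.exp (-g p / γ) / ∑ q, Real.exp (-g q / γ)) + y p -
          D * (Real.exp (-g p / γ) / ∑ q, Real.exp (-g q / γ)))) := by
  have hZ : 0 < ∑ q, Real.exp (-g q / γ) :=
    Finset.sum_pos (fun _ _ => Real.exp_pos _) Finset.univ_nonempty
  have h1 : ∀ p, Real.log (Real.exp (-g p / γ) / ∑ q, Real.exp (-g q / γ)) =
      -g p / γ - Real.log (∑ q, Real.exp (-g q / γ)) := fun p => by
    rw [Real.log_div (Real.exp_pos _).ne' hZ.ne', Real.log_exp]
  -- The weights sum to `1` and the `y p` to `D`, so the linear corrections cancel.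
  simp only [h1, Finset.sum_sub_distrib, Finset.sum_add_distrib, ← Finset.mul_sum, mul_sub,
    ← Finset.sum_mul, ← Finset.sum_div, hD, div_self hZ.ne']
  have h2 : γ * ∑ p, y p * (-g p / γ) = -∑ p, y p * g p := by
    rw [Finset.mul_sum, ← Finset.sum_neg_distrib]
    refine Finset.sum_congr rfl fun p _ => ?_
    field_simp
  linear_combination h2

theorem gibbs_le {ι : Type*} [Fintype ι] [Nonempty ι] (g y : ι → ℝ) {D γ : ℝ} (hγ : 0 < γ)
    (hy : ∀ p, 0 ≤ y p) (hD : ∑ p, y p = D) :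
    0 ≤ ∑ p, y p * g p + γ * ∑ p, y p * Real.log (y p / D) +
        D * (γ * Real.log (∑ p, Real.exp (-g p / γ))) := by
  have hZ : 0 < ∑ q, Real.exp (-g q / γ) :=
    Finset.sum_pos (fun _ _ => Real.exp_pos _) Finset.univ_nonempty
  rw [gibbs_gap g y hγ hD]
  refine mul_nonneg hγ.le (Finset.sum_nonneg fun p _ =>
    tangent_le_mul_log_div (hy p) ?_ (by positivity))
  exact hD ▸ Finset.single_le_sum (fun q _ => hy q) (Finset.mem_univ p)

theorem gibbs_eq_iff {ι : Type*} [Fintype ι] [Nonempty ι] (g y : ι → ℝ) {D γ : ℝ} (hγ : 0 < γ)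
    (hy : ∀ p, 0 ≤ y p) (hD : ∑ p, y p = D) :
    ∑ p, y p * g p + γ * ∑ p, y p * Real.log (y p / D) +
        D * (γ * Real.log (∑ p, Real.exp (-g p / γ))) = 0 ↔
      ∀ p, y p = D * (Real.exp (-g p / γ) / ∑ q, Real.exp (-g q / γ)) := by
  have hZ : 0 < ∑ q, Real.exp (-g q / γ) :=
    Finset.sum_pos (fun _ _ => Real.exp_pos _) Finset.univ_nonempty
  have hle : ∀ p, y p ≤ D := fun p =>
    hD ▸ Finset.single_le_sum (fun q _ => hy q) (Finset.mem_univ p)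
  rw [gibbs_gap g y hγ hD, mul_eq_zero, or_iff_right hγ.ne',
    Finset.sum_eq_zero_iff_of_nonneg fun p _ =>
      tangent_le_mul_log_div (hy p) (hle p) (by positivity)]
  simp only [Finset.mem_univ, true_imp_iff]
  exact forall_congr' fun p => tangent_eq_mul_log_div_iff (hy p) (hle p) (by positivity)

/-! ### Integrals of nondecreasing costs -/

/-- Convexity of the integral of a nondecreasing function, in subgradient form and for either order
of `a` and `b`. -/
theorem subgradient_costIntegral {c : ℝ → ℝ} (hc : ContinuousOn c (Set.Ici 0))
    (hm : MonotoneOn c (Set.Ici 0)) {a b : ℝ} (ha : 0 ≤ a) (hb : 0 ≤ b) :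
    c a * (b - a) ≤ costIntegral c b - costIntegral c a := by
  have hi : ∀ {u v : ℝ}, 0 ≤ u → 0 ≤ v → IntervalIntegrable c MeasureTheory.volume u v :=
    fun hu hv => (hc.mono fun z hz => (le_min hu hv).trans hz.1).intervalIntegrable
  have key : costIntegral c b - costIntegral c a = ∫ z in a..b, c z :=
    intervalIntegral.integral_interval_sub_left (hi le_rfl hb) (hi le_rfl ha)
  rw [key]
  rcases le_total a b with h | h
  · have := intervalIntegral.integral_mono_on h (_root_.intervalIntegrable_const (c := c a))
      (hi ha hb) fun z hz => hm ha (ha.trans hz.1) hz.1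
    simpa [mul_comm] using this
  · have := intervalIntegral.integral_mono_on h (hi hb ha)
      (_root_.intervalIntegrable_const (c := c a))
      fun z hz => hm (hb.trans hz.1) ha hz.2
    rw [intervalIntegral.integral_symm]
    simp only [intervalIntegral.integral_const, smul_eq_mul] at this
    linarith

theorem continuousOn_costIntegral {c : ℝ → ℝ} (hc : ContinuousOn c (Set.Ici 0)) :
    ContinuousOn (costIntegral c) (Set.Ici 0) := by
  -- Nothing is known about `c` on negative reals; its constant extension to the left has the same
  -- integrals.
  have hc' : Continuous fun z : ℝ => c (max z 0) :=
    hc.comp_continuous (continuous_id.max continuous_const) fun z => Set.mem_Ici.2 (le_max_right _ _)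
  have h : Continuous fun f : ℝ => ∫ z in (0 : ℝ)..f, c (max z 0) :=
    intervalIntegral.continuous_primitive (fun a b => hc'.intervalIntegrable a b) 0
  refine h.continuousOn.congr fun f hf => intervalIntegral.integral_congr fun z hz => ?_
  rw [Set.uIcc_of_le hf] at hz
  simp [max_eq_left hz.1]

/-- Equality in Fenchel–Young at `s = c a`, by the subgradient inequality. It provides both
finiteness of the conjugate there and its value. -/
theorem isGreatest_conjugate {c : ℝ → ℝ} (hc : ContinuousOn c (Set.Ici 0))
    (hm : MonotoneOn c (Set.Ici 0)) {a : ℝ} (ha : 0 ≤ a) :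
    IsGreatest ((fun f => f * c a - costIntegral c f) '' Set.Ici 0)
      (a * c a - costIntegral c a) := by
  refine ⟨⟨a, ha, rfl⟩, ?_⟩
  rintro _ ⟨b, hb, rfl⟩
  have := subgradient_costIntegral hc hm ha hb
  simp only
  linarith

theorem mul_sub_le_conjugate {c : ℝ → ℝ} {s f : ℝ} (hs : s ∈ conjugateDomain c) (hf : 0 ≤ f) :
    f * s - costIntegral c f ≤ conjugate c s :=
  le_csSup hs ⟨f, hf, rfl⟩

/-- The equality case of the Fenchel-Young inequality at an interior point. -/
theorem eq_of_conjugate_eq {c : ℝ → ℝ} (hc : ContinuousOn c (Set.Ici 0))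
    (hm : MonotoneOn c (Set.Ici 0)) {s f : ℝ} (hs : s ∈ conjugateDomain c) (hf : 0 < f)
    (h : f * s - costIntegral c f = conjugate c s) : s = c f := by
  have hcf : ContinuousAt c f := hc.continuousAt (Ici_mem_nhds hf)
  -- Maximality of `f` meets the subgradient inequality at `b`. Letting `b` tend to `f` from the
  -- right and from the left pins down `s`; the left limit needs `0 < f`.
  have key : ∀ b, 0 ≤ b → s * (b - f) ≤ c b * (b - f) := fun b hb => by
    have h1 := subgradient_costIntegral hc hm hb hf.le
    have h2 := h ▸ mul_sub_le_conjugate hs hb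
    linarith
  apply le_antisymm
  · refine ge_of_tendsto (hcf.tendsto.mono_left (nhdsWithin_le_nhds (s := Set.Ioi f))) ?_
    filter_upwards [self_mem_nhdsWithin] with b (hb : f < b)
    exact le_of_mul_le_mul_right (key b (hf.le.trans hb.le)) (by linarith)
  · refine le_of_tendsto (hcf.tendsto.mono_left (nhdsWithin_le_nhds (s := Set.Iio f))) ?_
    filter_upwards [self_mem_nhdsWithin, nhdsWithin_le_nhds (Ici_mem_nhds hf)] with b
      (hb : b < f) hb0
    have := key b hb0
    nlinarith

namespace MultilevelNetwork

variable {V : Type*} [DecidableEq V] (N : MultilevelNetwork V)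

instance nonempty_paths {k : Fin N.m} (w : {w : V × V // w ∈ N.OD k}) :
    Nonempty {p : List (V × V) // p ∈ N.paths k w} :=
  (N.paths_nonempty k w.1 w.2).to_subtype

/-! ### Feasible flows -/

theorem demand_succ (d : V × V → ℝ) (x : N.PathFlow) {j : ℕ} (h : j + 1 < N.m) :
    N.demand d x ⟨j + 1, h⟩ = N.edgeFlow (x ⟨j, Nat.lt_of_succ_lt h⟩) := rfl

theorem edgeFlow_nonneg {k : Fin N.m} {y : N.LevelFlow k} (hy : ∀ w p, 0 ≤ y w p) (e : V × V) :
    0 ≤ N.edgeFlow y e :=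
  Finset.sum_nonneg fun w _ => Finset.sum_nonneg fun p _ => by
    split_ifs
    exacts [hy w p, le_rfl]

/-- This is where the absence of superfluous edges enters; it carries positivity from one level to
the demands of the next. -/
theorem edgeFlow_pos {k : Fin N.m} {y : N.LevelFlow k} (hy : ∀ w p, 0 < y w p) {e : V × V}
    (he : e ∈ N.ordinary k ∪ N.OD (k + 1)) : 0 < N.edgeFlow y e := by
  obtain ⟨w, hw, p, hp, hep⟩ := N.edge_used k e he
  have h0 : ∀ (w) (p : {p : List (V × V) // p ∈ N.paths k w.1}),
      0 ≤ if e ∈ p.1 then y w p else 0 := fun w p => by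
    split_ifs
    exacts [(hy w p).le, le_rfl]
  refine Finset.sum_pos' (fun w _ => Finset.sum_nonneg fun p _ => h0 w p)
    ⟨⟨w, hw⟩, Finset.mem_univ _, Finset.sum_pos' (fun p _ => h0 _ p)
      ⟨⟨p, hp⟩, Finset.mem_univ _, ?_⟩⟩
  simpa [hep] using hy ⟨w, hw⟩ ⟨p, hp⟩

theorem edgeFlow_add_smul {k : Fin N.m} (y z : N.LevelFlow k) (a b : ℝ) (e : V × V) :
    N.edgeFlow (a • y + b • z) e = a * N.edgeFlow y e + b * N.edgeFlow z e := by
  simp only [edgeFlow, Finset.mul_sum, ← Finset.sum_add_distrib]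
  refine Finset.sum_congr rfl fun w _ => Finset.sum_congr rfl fun p _ => ?_
  split_ifs <;> simp

/-- The condition `a + b = 1` is due to the top level, whose demands are constant: demands are
affine in the flows, not linear. -/
theorem demand_add_smul (d : V × V → ℝ) (x y : N.PathFlow) {a b : ℝ} (hab : a + b = 1) :
    ∀ (k : Fin N.m) (w : V × V), N.demand d (a • x + b • y) k w =
      a * N.demand d x k w + b * N.demand d y k w
  | ⟨0, _⟩, w => by simp only [demand]; linear_combination -(d w) * hab
  | ⟨_ + 1, _⟩, w => N.edgeFlow_add_smul _ _ _ _ _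

variable {N}

theorem IsLevelFeasible.le {k : Fin N.m} {D : V × V → ℝ} {y : N.LevelFlow k}
    (h : N.IsLevelFeasible k D y) (w p) : y w p ≤ D w :=
  h.2 w ▸ Finset.single_le_sum (fun q _ => h.1 w q) (Finset.mem_univ p)

theorem IsFeasible.flowVec_nonneg {d : V × V → ℝ} {x : N.PathFlow} (h : N.IsFeasible d x)
    (e : N.Edge) : 0 ≤ N.flowVec x e :=
  N.edgeFlow_nonneg (h e.1).1 _

theorem IsFeasible.add_smul {d : V × V → ℝ} {x y : N.PathFlow} (hx : N.IsFeasible d x)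
    (hy : N.IsFeasible d y) {a b : ℝ} (ha : 0 ≤ a) (hb : 0 ≤ b) (hab : a + b = 1) :
    N.IsFeasible d (a • x + b • y) := by
  refine fun k => ⟨fun w p => ?_, fun w => ?_⟩
  · exact add_nonneg (mul_nonneg ha ((hx k).1 w p)) (mul_nonneg hb ((hy k).1 w p))
  · rw [N.demand_add_smul d x y hab, ← (hx k).2 w, ← (hy k).2 w, Finset.mul_sum, Finset.mul_sum,
      ← Finset.sum_add_distrib]
    rfl

theorem flowVec_add_smul (x y : N.PathFlow) (a b : ℝ) (e : N.Edge) :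
    N.flowVec (a • x + b • y) e = a * N.flowVec x e + b * N.flowVec y e :=
  N.edgeFlow_add_smul _ _ _ _ _

variable (N)

theorem exists_isLevelFeasible (k : Fin N.m) {D : V × V → ℝ} (hD : ∀ w ∈ N.OD k, 0 ≤ D w) :
    ∃ y, N.IsLevelFeasible k D y := by
  classical
  refine ⟨fun w p => if p = Classical.arbitrary _ then D w else 0, fun w p => ?_, fun w => ?_⟩
  · dsimp only
    split_ifs
    exacts [hD w w.2, le_rfl]
  · simp

theorem sum_level_telescope (B : ℕ → ℝ) (c : Fin N.m → ℝ)
    (h : ∀ k : Fin N.m, c k = B k - B (k + 1)) :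
    ∑ k, c k = B 0 - B N.m := by
  simp only [h]
  rw [Fin.sum_univ_eq_sum_range (fun k => B k - B (k + 1)) N.m, Finset.sum_range_sub']

/-! ### The entropy -/

/-- The entropy of the path flows `y` of level `k` with demands `D`. -/
noncomputable def levelEntropy (k : Fin N.m) (D : V × V → ℝ) (y : N.LevelFlow k) : ℝ :=
  ∑ w, ∑ p, y w p * Real.log (y w p / D w)

/-- The entropy part of the primal objective. -/
noncomputable def entropy (d : V × V → ℝ) (γ : Fin N.m → ℝ) (x : N.PathFlow) : ℝ :=
  ∑ k, γ k * N.levelEntropy k (N.demand d x k) (x k)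

theorem primalObjective_eq (d : V × V → ℝ) (γ : Fin N.m → ℝ) (τ : N.Edge → ℝ → ℝ)
    (x : N.PathFlow) : N.primalObjective d γ τ x =
      ∑ e, costIntegral (τ e) (N.flowVec x e) + N.entropy d γ x := by
  rw [Fintype.sum_sigma]
  simp only [entropy, ← Finset.sum_add_distrib]
  rfl

/-- The demands below the top level vary with the flows, so convexity of `x log (x / d)` is needed
jointly in both variables. -/
theorem entropy_add_smul_le {d : V × V → ℝ} {γ : Fin N.m → ℝ} (hγ : ∀ k, 0 ≤ γ k)
    {x y : N.PathFlow} (hx : N.IsFeasible d x) (hy : N.IsFeasible d y) {a b : ℝ} (ha : 0 < a)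
    (hb : 0 < b) (hab : a + b = 1) :
    N.entropy d γ (a • x + b • y) ≤ a * N.entropy d γ x + b * N.entropy d γ y := by
  have h : ∀ k, N.levelEntropy k (N.demand d (a • x + b • y) k) ((a • x + b • y) k) ≤
      a * N.levelEntropy k (N.demand d x k) (x k) +
        b * N.levelEntropy k (N.demand d y k) (y k) := fun k => by
    simp only [levelEntropy, Finset.mul_sum, ← Finset.sum_add_distrib]
    refine Finset.sum_le_sum fun w _ => Finset.sum_le_sum fun p _ => ?_
    rw [N.demand_add_smul d x y hab]
    exact convex_mul_log_div ((hx k).1 w p) ((hx k).le w p) ((hy k).1 w p) ((hy k).le w p) ha hb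
  simp only [entropy, Finset.mul_sum, ← Finset.sum_add_distrib]
  refine Finset.sum_le_sum fun k _ => ?_
  nlinarith [mul_le_mul_of_nonneg_left (h k) (hγ k)]

/-! ### Existence of a primal solution -/

theorem continuous_edgeFlow (k : Fin N.m) (e : V × V) :
    Continuous fun x : N.PathFlow => N.edgeFlow (x k) e := by
  refine continuous_finsetSum _ fun w _ => continuous_finsetSum _ fun p _ => ?_
  split_ifs <;> fun_prop

theorem continuous_demand (d : V × V → ℝ) (w : V × V) :
    ∀ k : Fin N.m, Continuous fun x : N.PathFlow => N.demand d x k w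
  | ⟨0, _⟩ => continuous_const
  | ⟨_ + 1, _⟩ => N.continuous_edgeFlow _ _

theorem isClosed_isFeasible (d : V × V → ℝ) : IsClosed {x | N.IsFeasible d x} := by
  simp only [IsFeasible, IsLevelFeasible, Set.ofPred_forall, Set.ofPred_and]
  refine isClosed_iInter fun k => IsClosed.inter ?_ ?_
  · exact isClosed_iInter fun w => isClosed_iInter fun p =>
      isClosed_le continuous_const (by fun_prop)
  · exact isClosed_iInter fun w => isClosed_eq (by fun_prop) (N.continuous_demand d w k)

theorem edgeFlow_le {k : Fin N.m} {D : V × V → ℝ} {y : N.LevelFlow k}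
    (h : N.IsLevelFeasible k D y) (e : V × V) :
    N.edgeFlow y e ≤ ∑ w : {w : V × V // w ∈ N.OD k}, D w := by
  refine Finset.sum_le_sum fun w _ => ?_
  rw [← h.2 w]
  refine Finset.sum_le_sum fun p _ => ?_
  split_ifs
  exacts [le_rfl, h.1 w p]

/-- No edge carries more than the total demand of its level, so bounds pass down the levels and make
the feasible set bounded. -/
theorem exists_demand_le (d : V × V → ℝ) (j : ℕ) :
    ∃ B : ℝ, ∀ x, N.IsFeasible d x → ∀ h : j < N.m, ∀ w ∈ N.OD j, N.demand d x ⟨j, h⟩ w ≤ B := by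
  induction j with
  | zero =>
    refine ⟨∑ w ∈ N.OD 0, |d w|, fun x _ h w hw => ?_⟩
    exact (le_abs_self _).trans
      (Finset.single_le_sum (f := fun w => |d w|) (fun w _ => abs_nonneg _) hw)
  | succ j ih =>
    obtain ⟨B, hB⟩ := ih
    refine ⟨∑ w : {w : V × V // w ∈ N.OD j}, B, fun x hx h w hw => ?_⟩
    exact (N.edgeFlow_le (hx ⟨j, Nat.lt_of_succ_lt h⟩) w).trans
      (Finset.sum_le_sum fun w _ => hB x hx _ w w.2)

theorem isCompact_isFeasible (d : V × V → ℝ) : IsCompact {x | N.IsFeasible d x} := by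
  choose B hB using N.exists_demand_le d
  refine (isCompact_univ_pi fun k : Fin N.m => isCompact_univ_pi fun w : {w : V × V // w ∈ N.OD k} =>
    isCompact_univ_pi fun _ : {p : List (V × V) // p ∈ N.paths k w.1} =>
      isCompact_Icc (a := (0 : ℝ)) (b := B k)).of_isClosed_subset (N.isClosed_isFeasible d) ?_
  intro x hx k _ w _ p _
  exact ⟨(hx k).1 w p, ((hx k).le w p).trans (hB k x hx k.2 w w.2)⟩

theorem continuousOn_primalObjective (d : V × V → ℝ) (γ : Fin N.m → ℝ) {τ : N.Edge → ℝ → ℝ}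
    (hτ : ∀ e, ContinuousOn (τ e) (Set.Ici 0)) :
    ContinuousOn (N.primalObjective d γ τ) {x | N.IsFeasible d x} := by
  simp only [funext (N.primalObjective_eq d γ τ), entropy, levelEntropy]
  refine (continuousOn_finsetSum _ fun e _ => ?_).add (continuousOn_finsetSum _ fun k _ =>
    continuousOn_const.mul (continuousOn_finsetSum _ fun w _ => continuousOn_finsetSum _
      fun p _ => ?_))
  · exact (continuousOn_costIntegral (hτ e)).comp
      (N.continuous_edgeFlow e.1 e.2).continuousOn fun x hx => IsFeasible.flowVec_nonneg hx e
  · exact continuousOn_mul_log_div.comp (f := fun x : N.PathFlow => (x k w p, N.demand d x k w))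
      ((by fun_prop : Continuous fun x : N.PathFlow => x k w p).prodMk
        (N.continuous_demand d w k)).continuousOn
      fun x hx => ⟨(hx k).1 w p, (hx k).le w p⟩

theorem exists_isPrimalSolution {d : V × V → ℝ} (γ : Fin N.m → ℝ) {τ : N.Edge → ℝ → ℝ}
    (hτ : ∀ e, ContinuousOn (τ e) (Set.Ici 0)) (hne : ∃ x, N.IsFeasible d x) :
    ∃ x, N.IsPrimalSolution d γ τ x := by
  obtain ⟨x, hx, hmin⟩ := (N.isCompact_isFeasible d).exists_isMinOn hne
    (N.continuousOn_primalObjective d γ hτ)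
  exact ⟨x, hx, fun y hy => hmin hy⟩

/-! ### The variational inequality -/

variable {N}

/-- First-order condition along the segment to `y`. The entropy is estimated by convexity instead of
being differentiated, so boundary flows and zero parameters cause no trouble. -/
theorem IsPrimalSolution.variational {d : V × V → ℝ} {γ : Fin N.m → ℝ} {τ : N.Edge → ℝ → ℝ}
    (hγ : ∀ k, 0 ≤ γ k) (hc : ∀ e, ContinuousOn (τ e) (Set.Ici 0))
    (hm : ∀ e, MonotoneOn (τ e) (Set.Ici 0)) {x : N.PathFlow}
    (hx : N.IsPrimalSolution d γ τ x) {y : N.PathFlow} (hy : N.IsFeasible d y) :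
    0 ≤ ∑ e, τ e (N.flowVec x e) * (N.flowVec y e - N.flowVec x e) +
      (N.entropy d γ y - N.entropy d γ x) := by
  have hcurve : ∀ e, Tendsto (fun b : ℝ => (1 - b) * N.flowVec x e + b * N.flowVec y e)
      (𝓝[Set.Ioo 0 1] 0) (𝓝[Set.Ici 0] (N.flowVec x e)) := fun e => by
    refine tendsto_nhdsWithin_iff.2 ⟨?_, ?_⟩
    · have : Continuous fun b : ℝ => (1 - b) * N.flowVec x e + b * N.flowVec y e := by fun_prop
      simpa using (this.tendsto 0).mono_left nhdsWithin_le_nhds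
    · filter_upwards [self_mem_nhdsWithin] with b hb
      exact add_nonneg (mul_nonneg (sub_nonneg.2 hb.2.le) (hx.1.flowVec_nonneg e))
        (mul_nonneg hb.1.le (hy.flowVec_nonneg e))
  have hlim : Tendsto (fun b : ℝ =>
      ∑ e, τ e ((1 - b) * N.flowVec x e + b * N.flowVec y e) * (N.flowVec y e - N.flowVec x e) +
      (N.entropy d γ y - N.entropy d γ x)) (𝓝[Set.Ioo 0 1] 0)
      (𝓝 (∑ e, τ e (N.flowVec x e) * (N.flowVec y e - N.flowVec x e) +
        (N.entropy d γ y - N.entropy d γ x))) :=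
    (tendsto_finsetSum _ fun e _ => ((hc e _ (hx.1.flowVec_nonneg e)).tendsto.comp
      (hcurve e)).mul_const _).add_const _
  have : (𝓝[Set.Ioo (0 : ℝ) 1] 0).NeBot := by
    rw [nhdsWithin_Ioo_eq_nhdsGT one_pos]
    infer_instance
  refine ge_of_tendsto hlim ?_
  filter_upwards [self_mem_nhdsWithin] with b hb
  have ha : 0 < 1 - b := sub_pos.2 hb.2
  have hab : 1 - b + b = 1 := by ring
  have hz := hx.1.add_smul hy ha.le hb.1.le hab
  have h1 := hx.2 _ hz
  rw [N.primalObjective_eq, N.primalObjective_eq] at h1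
  have h2 := N.entropy_add_smul_le hγ hx.1 hy ha hb.1 hab
  have h3 : ∑ e, costIntegral (τ e) (N.flowVec ((1 - b) • x + b • y) e) -
      ∑ e, costIntegral (τ e) (N.flowVec x e) ≤
      b * ∑ e, τ e ((1 - b) * N.flowVec x e + b * N.flowVec y e) *
        (N.flowVec y e - N.flowVec x e) := by
    rw [← Finset.sum_sub_distrib, Finset.mul_sum]
    refine Finset.sum_le_sum fun e _ => ?_
    -- The subgradient is taken at the intermediate point, which bounds the increase from above;
    -- continuity of `τ` then allows `b → 0`.
    have := subgradient_costIntegral (hc e) (hm e) (hz.flowVec_nonneg e) (hx.1.flowVec_nonneg e)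
    rw [flowVec_add_smul] at this ⊢
    linarith
  refine nonneg_of_mul_nonneg_right (a := b) ?_ hb.1
  linarith

/-- The costs on the edges are the same for all primal solutions, even if parameters vanish. -/
theorem IsPrimalSolution.cost_eq {d : V × V → ℝ} {γ : Fin N.m → ℝ} {τ : N.Edge → ℝ → ℝ}
    (hγ : ∀ k, 0 ≤ γ k) (hc : ∀ e, ContinuousOn (τ e) (Set.Ici 0))
    (hm : ∀ e, MonotoneOn (τ e) (Set.Ici 0)) {x y : N.PathFlow}
    (hx : N.IsPrimalSolution d γ τ x) (hy : N.IsPrimalSolution d γ τ y) (e : N.Edge) :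
    τ e (N.flowVec x e) = τ e (N.flowVec y e) := by
  have hterm : ∀ e, 0 ≤ (τ e (N.flowVec x e) - τ e (N.flowVec y e)) *
      (N.flowVec x e - N.flowVec y e) := fun e => by
    rcases le_total (N.flowVec x e) (N.flowVec y e) with h | h
    · exact mul_nonneg_of_nonpos_of_nonpos (sub_nonpos.2 <| hm e (hx.1.flowVec_nonneg e)
        (hy.1.flowVec_nonneg e) h) (sub_nonpos.2 h)
    · exact mul_nonneg (sub_nonneg.2 <| hm e (hy.1.flowVec_nonneg e)
        (hx.1.flowVec_nonneg e) h) (sub_nonneg.2 h)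
  have hsum : ∑ e, (τ e (N.flowVec x e) - τ e (N.flowVec y e)) *
      (N.flowVec x e - N.flowVec y e) ≤ 0 := by
    -- The entropy differences of the two inequalities cancel.
    have h1 := add_nonneg (hx.variational hγ hc hm hy.1) (hy.variational hγ hc hm hx.1)
    have h2 : ∑ e, (τ e (N.flowVec x e) - τ e (N.flowVec y e)) *
        (N.flowVec x e - N.flowVec y e) =
        -(∑ e, τ e (N.flowVec x e) * (N.flowVec y e - N.flowVec x e) +
          ∑ e, τ e (N.flowVec y e) * (N.flowVec x e - N.flowVec y e)) := by
      rw [← Finset.sum_add_distrib, ← Finset.sum_neg_distrib]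
      exact Finset.sum_congr rfl fun e _ => by ring
    linarith
  have h0 := (Finset.sum_eq_zero_iff_of_nonneg fun e _ => hterm e).1
    (le_antisymm hsum (Finset.sum_nonneg fun e _ => hterm e)) e (Finset.mem_univ e)
  rcases mul_eq_zero.1 h0 with h | h
  · exact sub_eq_zero.1 h
  · rw [sub_eq_zero.1 h]

end MultilevelNetwork

namespace MultilevelNetwork

variable {V : Type*} [DecidableEq V] (N : MultilevelNetwork V)

/-! ### Averaged costs of source-sink pairs -/

/-- The negative `γ ψ(t / γ)` of the averaged cost of the pair `w` of level `k`, and `0` when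
there is no level `k`. -/
noncomputable def potential (γ : Fin N.m → ℝ) (t : EuclideanSpace ℝ N.Edge) (k : ℕ) (w : V × V) :
    ℝ :=
  if h : k < N.m then γ ⟨k, h⟩ * N.pairPsi γ ⟨k, h⟩ w ((γ ⟨k, h⟩)⁻¹ • t) else 0

theorem potential_of_le (γ : Fin N.m → ℝ) (t : EuclideanSpace ℝ N.Edge) {k : ℕ} (h : N.m ≤ k)
    (w : V × V) : N.potential γ t k w = 0 :=
  dif_neg h.not_gt

theorem pathCost_eq (γ : Fin N.m → ℝ) (k : Fin N.m) (p : List (V × V))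
    (t : EuclideanSpace ℝ N.Edge) : N.pathCost γ k p t =
      (∑ e : {e : V × V // e ∈ N.ordinary k}, if e.1 ∈ p then t ⟨k, e⟩ else 0) -
        ∑ e ∈ N.OD (k + 1), if e ∈ p then N.potential γ t (k + 1) e else 0 := by
  rw [pathCost]
  congr 1
  by_cases h : (k : ℕ) + 1 < N.m
  · simp [potential, h]
  · simp [potential, h]

theorem potential_eq {γ : Fin N.m → ℝ} (hγ : ∀ k, 0 < γ k) (t : EuclideanSpace ℝ N.Edge)
    (k : Fin N.m) (w : V × V) : N.potential γ t k w =
      γ k * Real.log (∑ p ∈ N.paths k w, Real.exp (-N.pathCost γ k p t / γ k)) := by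
  rw [potential, dif_pos k.2, pairPsi, smul_smul, mul_inv_cancel₀ (hγ k).ne', one_smul]

/-- Exchange of the sums over paths and edges: the incidence matrix against its transpose. The index
`φ` makes it serve ordinary and nested edges alike. -/
theorem sum_mul_sum_ite {k : Fin N.m} (y : N.LevelFlow k) {ι : Type*} (s : Finset ι)
    (φ : ι → V × V) (c : ι → ℝ) :
    ∑ w, ∑ p, y w p * ∑ i ∈ s, (if φ i ∈ p.1 then c i else 0) =
      ∑ i ∈ s, c i * N.edgeFlow y (φ i) := by
  simp only [edgeFlow, Finset.mul_sum]
  rw [Finset.sum_comm (s := s)]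
  refine Finset.sum_congr rfl fun w _ => ?_
  rw [Finset.sum_comm (s := s)]
  refine Finset.sum_congr rfl fun p _ => Finset.sum_congr rfl fun i _ => ?_
  split_ifs <;> ring

theorem sum_mul_pathCost (γ : Fin N.m → ℝ) (k : Fin N.m) (t : EuclideanSpace ℝ N.Edge)
    (y : N.LevelFlow k) : ∑ w, ∑ p, y w p * N.pathCost γ k p t =
      ∑ e : {e : V × V // e ∈ N.ordinary k}, t ⟨k, e⟩ * N.edgeFlow y e -
        ∑ e ∈ N.OD (k + 1), N.potential γ t (k + 1) e * N.edgeFlow y e := by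
  simp only [pathCost_eq, mul_sub, Finset.sum_sub_distrib]
  exact congrArg₂ (· - ·)
    (N.sum_mul_sum_ite y Finset.univ (fun e : {e : V × V // e ∈ N.ordinary k} => e.1)
      fun e => t ⟨k, e⟩)
    (N.sum_mul_sum_ite y (N.OD (k + 1)) (fun e => e) (N.potential γ t (k + 1)))

/-- The gap in the Gibbs variational principle on one level. -/
theorem sum_gibbs_gap {γ : Fin N.m → ℝ} (hγ : ∀ k, 0 < γ k) (t : EuclideanSpace ℝ N.Edge)
    (k : Fin N.m) (D : V × V → ℝ) (y : N.LevelFlow k) :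
    ∑ w : {w : V × V // w ∈ N.OD k}, (∑ p, y w p * N.pathCost γ k p t +
      γ k * ∑ p, y w p * Real.log (y w p / D w) + D w * (γ k * Real.log
        (∑ p : {p : List (V × V) // p ∈ N.paths k w}, Real.exp (-N.pathCost γ k p t / γ k)))) =
    ∑ e : {e : V × V // e ∈ N.ordinary k}, t ⟨k, e⟩ * N.edgeFlow y e -
      ∑ e ∈ N.OD (k + 1), N.potential γ t (k + 1) e * N.edgeFlow y e +
      γ k * N.levelEntropy k D y + ∑ w ∈ N.OD k, N.potential γ t k w * D w := by
  rw [Finset.sum_add_distrib, Finset.sum_add_distrib, sum_mul_pathCost, ← Finset.mul_sum]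
  congr 1
  rw [← Finset.sum_coe_sort (N.OD k)]
  refine Finset.sum_congr rfl fun w _ => ?_
  rw [N.potential_eq hγ, ← Finset.sum_coe_sort (N.paths k w), mul_comm]

variable {N}

/-- The Gibbs variational principle on one level. -/
theorem IsLevelFeasible.gibbs_le {γ : Fin N.m → ℝ} (hγ : ∀ k, 0 < γ k)
    (t : EuclideanSpace ℝ N.Edge) {k : Fin N.m} {D : V × V → ℝ} {y : N.LevelFlow k}
    (hy : N.IsLevelFeasible k D y) :
    0 ≤ ∑ e : {e : V × V // e ∈ N.ordinary k}, t ⟨k, e⟩ * N.edgeFlow y e -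
      ∑ e ∈ N.OD (k + 1), N.potential γ t (k + 1) e * N.edgeFlow y e +
      γ k * N.levelEntropy k D y + ∑ w ∈ N.OD k, N.potential γ t k w * D w := by
  rw [← N.sum_gibbs_gap hγ]
  exact Finset.sum_nonneg fun w _ => _root_.gibbs_le _ _ (hγ k) (hy.1 w) (hy.2 w)

theorem IsLevelFeasible.gibbs_eq_iff {γ : Fin N.m → ℝ} (hγ : ∀ k, 0 < γ k)
    (t : EuclideanSpace ℝ N.Edge) {k : Fin N.m} {D : V × V → ℝ} {y : N.LevelFlow k}
    (hy : N.IsLevelFeasible k D y) :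
    ∑ e : {e : V × V // e ∈ N.ordinary k}, t ⟨k, e⟩ * N.edgeFlow y e -
      ∑ e ∈ N.OD (k + 1), N.potential γ t (k + 1) e * N.edgeFlow y e +
      γ k * N.levelEntropy k D y + ∑ w ∈ N.OD k, N.potential γ t k w * D w = 0 ↔
    ∀ w p, y w p = D w * (Real.exp (-N.pathCost γ k p t / γ k) /
      ∑ q ∈ N.paths k w, Real.exp (-N.pathCost γ k q t / γ k)) := by
  rw [← N.sum_gibbs_gap hγ, Finset.sum_eq_zero_iff_of_nonneg fun w _ =>
    _root_.gibbs_le _ _ (hγ k) (hy.1 w) (hy.2 w)]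
  simp only [Finset.mem_univ, true_imp_iff]
  refine forall_congr' fun w => ?_
  rw [_root_.gibbs_eq_iff _ _ (hγ k) (hy.1 w) (hy.2 w)]
  simp only [← Finset.sum_coe_sort (N.paths k w)]

variable (N)

/-! ### The Gibbs variational principle on all levels -/

theorem sum_potential_top (d : V × V → ℝ) (γ : Fin N.m → ℝ) (t : EuclideanSpace ℝ N.Edge) :
    ∑ w ∈ N.OD 0, N.potential γ t 0 w * d w = γ N.top * N.psi d γ ((γ N.top)⁻¹ • t) := by
  rw [psi, Finset.mul_sum]
  refine Finset.sum_congr rfl fun w _ => ?_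
  rw [potential, dif_pos N.m_pos]
  change γ N.top * _ * _ = _
  rw [mul_assoc, mul_comm (d w)]
  rfl

/-- The gap in the Gibbs variational principle on all levels. -/
theorem sum_level_gap (d : V × V → ℝ) (γ : Fin N.m → ℝ) (t : EuclideanSpace ℝ N.Edge)
    (x : N.PathFlow) :
    ∑ k : Fin N.m, (∑ e : {e : V × V // e ∈ N.ordinary k}, t ⟨k, e⟩ * N.edgeFlow (x k) e -
      ∑ e ∈ N.OD (k + 1), N.potential γ t (k + 1) e * N.edgeFlow (x k) e +
      γ k * N.levelEntropy k (N.demand d x k) (x k) +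
      ∑ w ∈ N.OD k, N.potential γ t k w * N.demand d x k w) =
    ∑ e, t e * N.flowVec x e + N.entropy d γ x + γ N.top * N.psi d γ ((γ N.top)⁻¹ • t) := by
  -- The nested-edge term of level `k` is the potential term of level `k + 1`; the default `0`
  -- closes the sum after the last level.
  have h := N.sum_level_telescope
    (fun k => if h : k < N.m then ∑ w ∈ N.OD k, N.potential γ t k w * N.demand d x ⟨k, h⟩ w else 0)
    (fun k => ∑ w ∈ N.OD k, N.potential γ t k w * N.demand d x k w -
      ∑ e ∈ N.OD (k + 1), N.potential γ t (k + 1) e * N.edgeFlow (x k) e) (fun k => by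
        rw [dif_pos k.2]
        congr 1
        by_cases hk : (k : ℕ) + 1 < N.m
        · rw [dif_pos hk]
          rfl
        · simp [hk, potential_of_le N γ t (not_lt.1 hk)])
  rw [dif_pos N.m_pos, dif_neg (lt_irrefl _), sub_zero] at h
  rw [← N.sum_potential_top, Fintype.sum_sigma, entropy]
  change _ = _ + _ + ∑ w ∈ N.OD 0, N.potential γ t 0 w * N.demand d x ⟨0, N.m_pos⟩ w
  rw [← h, ← Finset.sum_add_distrib, ← Finset.sum_add_distrib]
  refine Finset.sum_congr rfl fun k _ => ?_
  change _ = ∑ e : {e : V × V // e ∈ N.ordinary k}, t ⟨k, e⟩ * N.edgeFlow (x k) e + _ + _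
  ring

variable {N}

theorem IsFeasible.gibbs_le {d : V × V → ℝ} {γ : Fin N.m → ℝ} (hγ : ∀ k, 0 < γ k)
    (t : EuclideanSpace ℝ N.Edge) {x : N.PathFlow} (hx : N.IsFeasible d x) :
    0 ≤ ∑ e, t e * N.flowVec x e + N.entropy d γ x +
      γ N.top * N.psi d γ ((γ N.top)⁻¹ • t) := by
  rw [← N.sum_level_gap]
  exact Finset.sum_nonneg fun k _ => (hx k).gibbs_le hγ t

theorem IsFeasible.gibbs_eq_iff {d : V × V → ℝ} {γ : Fin N.m → ℝ} (hγ : ∀ k, 0 < γ k)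
    (t : EuclideanSpace ℝ N.Edge) {x : N.PathFlow} (hx : N.IsFeasible d x) :
    ∑ e, t e * N.flowVec x e + N.entropy d γ x + γ N.top * N.psi d γ ((γ N.top)⁻¹ • t) = 0 ↔
      N.IsGibbsFlow d γ t x := by
  rw [← N.sum_level_gap, Finset.sum_eq_zero_iff_of_nonneg fun k _ => (hx k).gibbs_le hγ t]
  simp only [Finset.mem_univ, true_imp_iff]
  exact forall_congr' fun k => (hx k).gibbs_eq_iff hγ t

/-! ### Gibbs flows -/

/-- The formula is recursive: the demands of a level are fixed by the flows of the previous one,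
starting from `d`. -/
theorem IsGibbsFlow.unique {d : V × V → ℝ} {γ : Fin N.m → ℝ} {t : EuclideanSpace ℝ N.Edge}
    {x y : N.PathFlow} (hx : N.IsGibbsFlow d γ t x) (hy : N.IsGibbsFlow d γ t y) : x = y := by
  have step : ∀ k : Fin N.m, N.demand d x k = N.demand d y k → x k = y k := fun k h => by
    funext w p
    rw [hx, hy, h]
  have hdem : ∀ n, ∀ h : n < N.m, N.demand d x ⟨n, h⟩ = N.demand d y ⟨n, h⟩ := by
    intro n
    induction n with
    | zero => exact fun _ => rfl
    | succ n ih => exact fun h => by rw [demand_succ, demand_succ, step _ (ih _)]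
  exact funext fun k => step k (hdem k k.2)

theorem IsGibbsFlow.pos {d : V × V → ℝ} (hd : ∀ w ∈ N.OD 0, 0 < d w) {γ : Fin N.m → ℝ}
    {t : EuclideanSpace ℝ N.Edge} {x : N.PathFlow} (hx : N.IsGibbsFlow d γ t x) (k : Fin N.m) :
    ∀ w p, 0 < x k w p := by
  have step : ∀ k : Fin N.m, (∀ w ∈ N.OD k, 0 < N.demand d x k w) → ∀ w p, 0 < x k w p :=
    fun k h w p => by
      rw [hx]
      exact mul_pos (h w w.2) (div_pos (Real.exp_pos _)
        (Finset.sum_pos (fun _ _ => Real.exp_pos _) (N.paths_nonempty k w w.2)))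
  have hdem : ∀ n, ∀ h : n < N.m, ∀ w ∈ N.OD n, 0 < N.demand d x ⟨n, h⟩ w := by
    intro n
    induction n with
    | zero => exact fun _ => hd
    | succ n ih =>
      exact fun h w hw => N.edgeFlow_pos (step _ (ih _)) (Finset.mem_union_right _ hw)
  exact step k (hdem k k.2)

theorem IsGibbsFlow.flowVec_pos {d : V × V → ℝ} (hd : ∀ w ∈ N.OD 0, 0 < d w) {γ : Fin N.m → ℝ}
    {t : EuclideanSpace ℝ N.Edge} {x : N.PathFlow} (hx : N.IsGibbsFlow d γ t x) (e : N.Edge) :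
    0 < N.flowVec x e :=
  N.edgeFlow_pos (hx.pos hd e.1) (Finset.mem_union_left _ e.2.2)

theorem IsGibbsFlow.isFeasible {d : V × V → ℝ} (hd : ∀ w ∈ N.OD 0, 0 < d w) {γ : Fin N.m → ℝ}
    {t : EuclideanSpace ℝ N.Edge} {x : N.PathFlow} (hx : N.IsGibbsFlow d γ t x) :
    N.IsFeasible d x := by
  refine fun k => ⟨fun w p => (hx.pos hd k w p).le, fun w => ?_⟩
  have hZ : 0 < ∑ q ∈ N.paths k w, Real.exp (-N.pathCost γ k q t / γ k) :=
    Finset.sum_pos (fun _ _ => Real.exp_pos _) (N.paths_nonempty k w w.2)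
  simp only [hx k w, ← Finset.mul_sum, ← Finset.sum_div]
  rw [Finset.sum_coe_sort (N.paths k w) fun p => Real.exp (-N.pathCost γ k p t / γ k),
    div_self hZ.ne', mul_one]

variable (N)

/-- The Gibbs distribution of the demands `D` on the paths of level `k`. -/
noncomputable def gibbsLevel (γ : Fin N.m → ℝ) (t : EuclideanSpace ℝ N.Edge) (k : Fin N.m)
    (D : V × V → ℝ) : N.LevelFlow k :=
  fun w p => D w * (Real.exp (-N.pathCost γ k p t / γ k) /
    ∑ q ∈ N.paths k w, Real.exp (-N.pathCost γ k q t / γ k))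

/-- The demands generated by the Gibbs distributions of the previous levels. -/
noncomputable def gibbsDemand (d : V × V → ℝ) (γ : Fin N.m → ℝ) (t : EuclideanSpace ℝ N.Edge) :
    ℕ → V × V → ℝ
  | 0 => d
  | k + 1 => if h : k < N.m then
      N.edgeFlow (N.gibbsLevel γ t ⟨k, h⟩ (gibbsDemand d γ t k)) else 0

theorem exists_isGibbsFlow (d : V × V → ℝ) (γ : Fin N.m → ℝ) (t : EuclideanSpace ℝ N.Edge) :
    ∃ x, N.IsGibbsFlow d γ t x := by
  let x : N.PathFlow := fun k => N.gibbsLevel γ t k (N.gibbsDemand d γ t k)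
  have h : ∀ k : Fin N.m, N.demand d x k = N.gibbsDemand d γ t k := by
    rintro ⟨_ | k, hk⟩
    · rfl
    · rw [demand_succ, gibbsDemand, dif_pos (Nat.lt_of_succ_lt hk)]
  exact ⟨x, fun k w p => by rw [h]; rfl⟩

/-! ### Differentiability of the dual objective -/

/-- Induction from the last level upwards, `n` bounding the number of levels left. Membership in `OD
k` keeps the argument of the logarithm positive. -/
theorem differentiable_pairPsi (γ : Fin N.m → ℝ) (k : Fin N.m) :
    ∀ w ∈ N.OD k, Differentiable ℝ (N.pairPsi γ k w) := by
  obtain ⟨n, hn⟩ : ∃ n, N.m ≤ k + n := ⟨N.m, by omega⟩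
  induction n generalizing k with
  | zero => exact absurd k.2 (by omega)
  | succ n ih =>
    have hpot : ∀ e ∈ N.OD (k + 1), Differentiable ℝ fun t => N.potential γ t (k + 1) e := by
      intro e he
      by_cases h : (k : ℕ) + 1 < N.m
      · simp only [potential, dif_pos h]
        exact ((ih ⟨k + 1, h⟩ (by simp only; omega) e he).comp
          (g := N.pairPsi γ ⟨k + 1, h⟩ e) (differentiable_id.const_smul (γ ⟨k + 1, h⟩)⁻¹)).const_mul _
      · simp only [potential, dif_neg h]
        exact differentiable_const _
    have hpath : ∀ p, Differentiable ℝ fun t => N.pathCost γ k p t := by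
      intro p
      simp only [pathCost_eq]
      refine (Differentiable.fun_sum fun e _ => ?_).sub (Differentiable.fun_sum fun e he => ?_)
      · split_ifs <;> fun_prop
      · split_ifs
        exacts [hpot e he, differentiable_const _]
    intro w hw
    have heq : N.pairPsi γ k w = fun s =>
        Real.log (∑ p ∈ N.paths k w, Real.exp (-N.pathCost γ k p (γ k • s) / γ k)) :=
      funext fun s => by rw [pairPsi]
    rw [heq]
    refine Differentiable.log (Differentiable.fun_sum fun p _ => ?_) fun s =>
      (Finset.sum_pos (fun _ _ => Real.exp_pos _) (N.paths_nonempty k w hw)).ne'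
    have hp : Differentiable ℝ fun s : EuclideanSpace ℝ N.Edge => N.pathCost γ k p (γ k • s) :=
      (hpath p).comp (differentiable_id.const_smul (γ k))
    simp only [div_eq_mul_inv]
    exact (hp.fun_neg.mul_const _).exp

theorem differentiable_psi (d : V × V → ℝ) (γ : Fin N.m → ℝ) :
    Differentiable ℝ (N.psi d γ) :=
  Differentiable.fun_sum fun w hw => (N.differentiable_pairPsi γ N.top w hw).const_mul _

/-- The gradient of `ψ` is given by the Gibbs flows. -/
theorem IsGibbsFlow.hasGradientAt_psi {N : MultilevelNetwork V} {d : V × V → ℝ}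
    (hd : ∀ w ∈ N.OD 0, 0 < d w) {γ : Fin N.m → ℝ} (hγ : ∀ k, 0 < γ k)
    {t : EuclideanSpace ℝ N.Edge} {x : N.PathFlow} (hx : N.IsGibbsFlow d γ t x) :
    HasGradientAt (N.psi d γ) (-N.flowVec x) ((γ N.top)⁻¹ • t) := by
  have hγ0 := hγ N.top
  have hfe := hx.isFeasible hd
  have hinner : ∀ s : EuclideanSpace ℝ N.Edge,
      inner ℝ (N.flowVec x) s = ∑ e, s e * N.flowVec x e := fun s => by
    simp [PiLp.inner_apply]
  -- The Gibbs inequality is an equality at `t`, so this sum is minimal there. Its derivative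
  -- vanishes, and no chain rule through the levels is needed.
  have hmin : IsLocalMin (fun s => N.psi d γ s + InnerProductSpace.toDual ℝ _ (N.flowVec x) s)
      ((γ N.top)⁻¹ • t) := by
    refine Filter.Eventually.of_forall fun s => ?_
    have h1 := (hfe.gibbs_eq_iff hγ t).2 hx
    have h2 := hfe.gibbs_le hγ (γ N.top • s)
    rw [smul_smul, inv_mul_cancel₀ hγ0.ne', one_smul] at h2
    simp only [InnerProductSpace.toDual_apply_apply, hinner, PiLp.smul_apply, smul_eq_mul, mul_assoc,
      ← Finset.mul_sum] at h1 h2 ⊢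
    refine le_of_mul_le_mul_left ?_ hγ0
    rw [mul_add, ← mul_assoc _ (γ N.top)⁻¹, mul_inv_cancel₀ hγ0.ne']
    linarith
  have hdiff := (N.differentiable_psi d γ ((γ N.top)⁻¹ • t)).hasFDerivAt
  have h0 := hmin.hasFDerivAt_eq_zero
    (hdiff.add (InnerProductSpace.toDual ℝ _ (N.flowVec x)).hasFDerivAt)
  rw [hasGradientAt_iff_hasFDerivAt, map_neg, ← eq_neg_of_add_eq_zero_left h0]
  exact hdiff

end MultilevelNetwork

namespace MultilevelNetwork

variable {V : Type*} [DecidableEq V] {N : MultilevelNetwork V}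

/-! ### Duality -/

theorem weak_duality {d : V × V → ℝ} {γ : Fin N.m → ℝ} (hγ : ∀ k, 0 < γ k)
    {τ : N.Edge → ℝ → ℝ} {t : EuclideanSpace ℝ N.Edge} (ht : t ∈ N.dualDomain τ)
    {x : N.PathFlow} (hx : N.IsFeasible d x) :
    -N.dualObjective d γ τ t ≤ N.primalObjective d γ τ x := by
  have h1 := hx.gibbs_le hγ t
  have h2 : ∑ e, t e * N.flowVec x e ≤
      ∑ e, (conjugate (τ e) (t e) + costIntegral (τ e) (N.flowVec x e)) :=
    Finset.sum_le_sum fun e _ => by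
      have := mul_sub_le_conjugate (ht e) (hx.flowVec_nonneg e)
      linarith
  rw [Finset.sum_add_distrib] at h2
  rw [dualObjective, N.primalObjective_eq]
  linarith

/-- With no gap, the Gibbs inequality and every Fenchel–Young inequality are tight. Positivity of
Gibbs flows then places each edge in the interior case of `eq_of_conjugate_eq`. -/
theorem isGibbsFlow_and_cost_eq_of_duality {d : V × V → ℝ} (hd : ∀ w ∈ N.OD 0, 0 < d w)
    {γ : Fin N.m → ℝ} (hγ : ∀ k, 0 < γ k) {τ : N.Edge → ℝ → ℝ}
    (hc : ∀ e, ContinuousOn (τ e) (Set.Ici 0)) (hm : ∀ e, MonotoneOn (τ e) (Set.Ici 0))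
    {t : EuclideanSpace ℝ N.Edge} (ht : t ∈ N.dualDomain τ)
    {x : N.PathFlow} (hx : N.IsFeasible d x)
    (h : N.primalObjective d γ τ x ≤ -N.dualObjective d γ τ t) :
    N.IsGibbsFlow d γ t x ∧ ∀ e, t e = τ e (N.flowVec x e) := by
  have h1 := hx.gibbs_le hγ t
  have h2 : ∀ e, 0 ≤ conjugate (τ e) (t e) -
      (N.flowVec x e * t e - costIntegral (τ e) (N.flowVec x e)) := fun e =>
    sub_nonneg.2 (mul_sub_le_conjugate (ht e) (hx.flowVec_nonneg e))
  have h3 := Finset.sum_nonneg fun e (_ : e ∈ Finset.univ) => h2 e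
  have h4 : ∑ e, (conjugate (τ e) (t e) -
      (N.flowVec x e * t e - costIntegral (τ e) (N.flowVec x e))) =
      ∑ e, conjugate (τ e) (t e) - ∑ e, t e * N.flowVec x e +
        ∑ e, costIntegral (τ e) (N.flowVec x e) := by
    rw [← Finset.sum_sub_distrib, ← Finset.sum_add_distrib]
    exact Finset.sum_congr rfl fun e _ => by ring
  rw [dualObjective, N.primalObjective_eq] at h
  have hG := (hx.gibbs_eq_iff hγ t).1 (le_antisymm (by linarith) h1)
  refine ⟨hG, fun e => eq_of_conjugate_eq (hc e) (hm e) (ht e) (hG.flowVec_pos hd e) ?_⟩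
  have h5 := (Finset.sum_eq_zero_iff_of_nonneg fun e _ => h2 e).1
    (le_antisymm (by linarith) h3) e (Finset.mem_univ e)
  linarith

theorem mem_dualDomain_of_cost_eq {d : V × V → ℝ} {τ : N.Edge → ℝ → ℝ}
    (hc : ∀ e, ContinuousOn (τ e) (Set.Ici 0)) (hm : ∀ e, MonotoneOn (τ e) (Set.Ici 0))
    {t : EuclideanSpace ℝ N.Edge} {x : N.PathFlow} (hx : N.IsFeasible d x)
    (ht : ∀ e, t e = τ e (N.flowVec x e)) : t ∈ N.dualDomain τ := fun e => by
  rw [ht e]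
  exact (isGreatest_conjugate (hc e) (hm e) (hx.flowVec_nonneg e)).bddAbove

theorem conjugate_eq_of_cost_eq {d : V × V → ℝ} {τ : N.Edge → ℝ → ℝ}
    (hc : ∀ e, ContinuousOn (τ e) (Set.Ici 0)) (hm : ∀ e, MonotoneOn (τ e) (Set.Ici 0))
    {t : EuclideanSpace ℝ N.Edge} {x : N.PathFlow} (hx : N.IsFeasible d x)
    (ht : ∀ e, t e = τ e (N.flowVec x e)) (e : N.Edge) :
    conjugate (τ e) (t e) = t e * N.flowVec x e - costIntegral (τ e) (N.flowVec x e) := by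
  rw [ht e, mul_comm]
  exact (isGreatest_conjugate (hc e) (hm e) (hx.flowVec_nonneg e)).csSup_eq

theorem strong_duality {d : V × V → ℝ} (hd : ∀ w ∈ N.OD 0, 0 < d w)
    {γ : Fin N.m → ℝ} (hγ : ∀ k, 0 < γ k) {τ : N.Edge → ℝ → ℝ}
    (hc : ∀ e, ContinuousOn (τ e) (Set.Ici 0)) (hm : ∀ e, MonotoneOn (τ e) (Set.Ici 0))
    {t : EuclideanSpace ℝ N.Edge} {x : N.PathFlow} (hx : N.IsGibbsFlow d γ t x)
    (ht : ∀ e, t e = τ e (N.flowVec x e)) :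
    N.primalObjective d γ τ x = -N.dualObjective d γ τ t := by
  have hfe := hx.isFeasible hd
  have h1 := (hfe.gibbs_eq_iff hγ t).2 hx
  rw [dualObjective, N.primalObjective_eq]
  simp only [conjugate_eq_of_cost_eq hc hm hfe ht, Finset.sum_sub_distrib]
  linarith

/-- A primal solution is a Gibbs flow at its edge costs. -/
theorem IsPrimalSolution.isGibbsFlow {d : V × V → ℝ} (hd : ∀ w ∈ N.OD 0, 0 < d w)
    {γ : Fin N.m → ℝ} (hγ : ∀ k, 0 < γ k) {τ : N.Edge → ℝ → ℝ}
    (hc : ∀ e, ContinuousOn (τ e) (Set.Ici 0)) (hm : ∀ e, MonotoneOn (τ e) (Set.Ici 0))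
    {x : N.PathFlow} (hx : N.IsPrimalSolution d γ τ x) {t : EuclideanSpace ℝ N.Edge}
    (ht : ∀ e, t e = τ e (N.flowVec x e)) : N.IsGibbsFlow d γ t x := by
  -- The competitor is the minimizer of the linearized problem; the variational inequality says that
  -- `x` does no worse.
  obtain ⟨y, hy⟩ := N.exists_isGibbsFlow d γ t
  have hyf := hy.isFeasible hd
  have h1 := (hyf.gibbs_eq_iff hγ t).2 hy
  have h2 := hx.variational (fun k => (hγ k).le) hc hm hyf
  simp only [← ht, mul_sub, Finset.sum_sub_distrib] at h2
  exact (hx.1.gibbs_eq_iff hγ t).1 (le_antisymm (by linarith) (hx.1.gibbs_le hγ t))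

/-! ### The nested problem -/

variable (N)

theorem nestedValue_of_lt (γ : Fin N.m → ℝ) (τ : N.Edge → ℝ → ℝ) (k : Fin N.m) (D : V × V → ℝ) :
    N.nestedValue γ τ k D = sInf {v | ∃ y : N.LevelFlow k, N.IsLevelFeasible k D y ∧
      v = N.levelCost γ τ k D y + N.nestedValue γ τ (k + 1) (N.edgeFlow y)} := by
  rw [nestedValue, dif_pos k.2]

theorem nestedValue_of_le (γ : Fin N.m → ℝ) (τ : N.Edge → ℝ → ℝ) {k : ℕ} (h : N.m ≤ k)
    (D : V × V → ℝ) : N.nestedValue γ τ k D = 0 := by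
  rw [nestedValue, dif_neg h.not_gt]

/-- The dual lower bound for the nested problems that start with level `k`. -/
noncomputable def nestedBound (γ : Fin N.m → ℝ) (τ : N.Edge → ℝ → ℝ)
    (t : EuclideanSpace ℝ N.Edge) (k : ℕ) (D : V × V → ℝ) : ℝ :=
  -∑ w ∈ N.OD k, N.potential γ t k w * D w - ∑ j : Fin N.m, if k ≤ j then
    ∑ e : {e : V × V // e ∈ N.ordinary j}, conjugate (τ ⟨j, e⟩) (t ⟨j, e⟩) else 0

theorem nestedBound_of_le (γ : Fin N.m → ℝ) (τ : N.Edge → ℝ → ℝ) (t : EuclideanSpace ℝ N.Edge)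
    {k : ℕ} (h : N.m ≤ k) (D : V × V → ℝ) : N.nestedBound γ τ t k D = 0 := by
  have : ∀ j : Fin N.m, ¬ k ≤ j := fun j => by omega
  simp [nestedBound, N.potential_of_le γ t h, this]

/-- One step of the dynamic programming recursion: the excess over the bound is the Gibbs gap plus
the Fenchel–Young gaps of the level. -/
theorem levelCost_add_nestedBound (γ : Fin N.m → ℝ) (τ : N.Edge → ℝ → ℝ)
    (t : EuclideanSpace ℝ N.Edge) (k : Fin N.m) (D : V × V → ℝ) (y : N.LevelFlow k) :
    N.levelCost γ τ k D y + N.nestedBound γ τ t (k + 1) (N.edgeFlow y) =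
      N.nestedBound γ τ t k D +
      (∑ e : {e : V × V // e ∈ N.ordinary k}, t ⟨k, e⟩ * N.edgeFlow y e -
        ∑ e ∈ N.OD (k + 1), N.potential γ t (k + 1) e * N.edgeFlow y e +
        γ k * N.levelEntropy k D y + ∑ w ∈ N.OD k, N.potential γ t k w * D w) +
      ∑ e : {e : V × V // e ∈ N.ordinary k}, (conjugate (τ ⟨k, e⟩) (t ⟨k, e⟩) -
        (t ⟨k, e⟩ * N.edgeFlow y e - costIntegral (τ ⟨k, e⟩) (N.edgeFlow y e))) := by
  have h : ∀ c : Fin N.m → ℝ, (∑ j : Fin N.m, if (k : ℕ) ≤ j then c j else 0) =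
      c k + ∑ j : Fin N.m, if (k : ℕ) + 1 ≤ j then c j else 0 := fun c => by
    have h1 : ∀ j : Fin N.m, (if (k : ℕ) ≤ j then c j else 0) =
        (if k = j then c j else 0) + if (k : ℕ) + 1 ≤ j then c j else 0 := fun j => by
      rcases lt_trichotomy k j with h | rfl | h
      · simp [h.ne, Fin.lt_def.1 h, (Fin.lt_def.1 h).le]
      · simp
      · have h' := Fin.lt_def.1 h
        rw [if_neg (by omega), if_neg h.ne', if_neg (by omega), add_zero]
    simp only [h1, Finset.sum_add_distrib, Finset.sum_ite_eq, Finset.mem_univ, if_true]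
  rw [nestedBound, nestedBound, h]
  simp only [Finset.sum_sub_distrib]
  change ∑ e : {e : V × V // e ∈ N.ordinary k}, _ + γ k * N.levelEntropy k D y + _ = _
  ring

variable {N}

theorem nestedBound_le_levelCost_add {γ : Fin N.m → ℝ} (hγ : ∀ k, 0 < γ k)
    {τ : N.Edge → ℝ → ℝ} {t : EuclideanSpace ℝ N.Edge} (ht : t ∈ N.dualDomain τ)
    {k : Fin N.m} {D : V × V → ℝ} {y : N.LevelFlow k} (hy : N.IsLevelFeasible k D y) :
    N.nestedBound γ τ t k D ≤
      N.levelCost γ τ k D y + N.nestedBound γ τ t (k + 1) (N.edgeFlow y) := by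
  rw [levelCost_add_nestedBound, add_assoc]
  refine le_add_of_nonneg_right (add_nonneg (hy.gibbs_le hγ t) (Finset.sum_nonneg fun e _ => ?_))
  have := mul_sub_le_conjugate (ht ⟨k, e⟩) (N.edgeFlow_nonneg hy.1 e)
  linarith

theorem nestedBound_le_nestedValue {γ : Fin N.m → ℝ} (hγ : ∀ k, 0 < γ k)
    {τ : N.Edge → ℝ → ℝ} {t : EuclideanSpace ℝ N.Edge} (ht : t ∈ N.dualDomain τ)
    (k : ℕ) {D : V × V → ℝ} (hD : ∀ w ∈ N.OD k, 0 ≤ D w) :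
    N.nestedBound γ τ t k D ≤ N.nestedValue γ τ k D := by
  obtain ⟨n, hn⟩ : ∃ n, N.m ≤ k + n := ⟨N.m, by omega⟩
  induction n generalizing k D with
  | zero =>
    rw [add_zero] at hn
    rw [N.nestedBound_of_le γ τ t hn, N.nestedValue_of_le γ τ hn]
  | succ n ih =>
    rcases le_or_gt N.m k with h | h
    · rw [N.nestedBound_of_le γ τ t h, N.nestedValue_of_le γ τ h]
    -- A lower bound passes to `sInf` only if the set is nonempty.
    · obtain ⟨y₀, hy₀⟩ := N.exists_isLevelFeasible ⟨k, h⟩ hD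
      rw [N.nestedValue_of_lt γ τ ⟨k, h⟩]
      refine le_csInf ⟨_, y₀, hy₀, rfl⟩ ?_
      rintro _ ⟨y, hy, rfl⟩
      exact (nestedBound_le_levelCost_add hγ ht hy).trans (add_le_add_right
        (ih (k + 1) (fun w _ => N.edgeFlow_nonneg hy.1 w) (by omega)) _)

theorem IsGibbsFlow.levelCost_add_nestedBound_eq {d : V × V → ℝ} (hd : ∀ w ∈ N.OD 0, 0 < d w)
    {γ : Fin N.m → ℝ} (hγ : ∀ k, 0 < γ k) {τ : N.Edge → ℝ → ℝ}
    (hc : ∀ e, ContinuousOn (τ e) (Set.Ici 0)) (hm : ∀ e, MonotoneOn (τ e) (Set.Ici 0))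
    {t : EuclideanSpace ℝ N.Edge} {x : N.PathFlow} (hx : N.IsGibbsFlow d γ t x)
    (ht : ∀ e, t e = τ e (N.flowVec x e)) (k : Fin N.m) :
    N.levelCost γ τ k (N.demand d x k) (x k) + N.nestedBound γ τ t (k + 1) (N.edgeFlow (x k)) =
      N.nestedBound γ τ t k (N.demand d x k) := by
  have hfe := hx.isFeasible hd
  rw [levelCost_add_nestedBound, ((hfe k).gibbs_eq_iff hγ t).2 (hx k), add_zero,
    Finset.sum_eq_zero, add_zero]
  exact fun e _ => sub_eq_zero.2 (conjugate_eq_of_cost_eq hc hm hfe ht ⟨k, e⟩)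

theorem IsGibbsFlow.nestedValue_eq {d : V × V → ℝ} (hd : ∀ w ∈ N.OD 0, 0 < d w)
    {γ : Fin N.m → ℝ} (hγ : ∀ k, 0 < γ k) {τ : N.Edge → ℝ → ℝ}
    (hc : ∀ e, ContinuousOn (τ e) (Set.Ici 0)) (hm : ∀ e, MonotoneOn (τ e) (Set.Ici 0))
    {t : EuclideanSpace ℝ N.Edge} {x : N.PathFlow} (hx : N.IsGibbsFlow d γ t x)
    (ht : ∀ e, t e = τ e (N.flowVec x e)) (k : Fin N.m) :
    N.nestedValue γ τ (k + 1) (N.edgeFlow (x k)) =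
      N.nestedBound γ τ t (k + 1) (N.edgeFlow (x k)) := by
  have hfe := hx.isFeasible hd
  have hdom := mem_dualDomain_of_cost_eq hc hm hfe ht
  obtain ⟨n, hn⟩ : ∃ n, N.m ≤ k + n := ⟨N.m, by omega⟩
  induction n generalizing k with
  | zero => exact absurd k.2 (by omega)
  | succ n ih =>
    refine le_antisymm ?_
      (nestedBound_le_nestedValue hγ hdom _ fun w _ => N.edgeFlow_nonneg (hfe k).1 w)
    rcases le_or_gt N.m (k + 1) with h | h
    · rw [N.nestedBound_of_le γ τ t h, N.nestedValue_of_le γ τ h]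
    · have hstep := hx.levelCost_add_nestedBound_eq hd hγ hc hm ht ⟨k + 1, h⟩
      rw [← ih ⟨k + 1, h⟩ (by simp only; omega)] at hstep
      refine ((N.nestedValue_of_lt γ τ ⟨k + 1, h⟩ _).trans_le (csInf_le ?_
        ⟨x ⟨k + 1, h⟩, hfe ⟨k + 1, h⟩, rfl⟩)).trans hstep.le
      -- Boundedness below, required for the infimum to lie under the value at `x`, is again the
      -- dual bound.
      refine ⟨N.nestedBound γ τ t (k + 1) (N.edgeFlow (x k)), ?_⟩
      rintro _ ⟨y, hy, rfl⟩
      exact (nestedBound_le_levelCost_add hγ hdom hy).trans (add_le_add_right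
        (nestedBound_le_nestedValue hγ hdom _ fun w _ => N.edgeFlow_nonneg hy.1 w) _)

theorem IsGibbsFlow.isNestedSolution {d : V × V → ℝ} (hd : ∀ w ∈ N.OD 0, 0 < d w)
    {γ : Fin N.m → ℝ} (hγ : ∀ k, 0 < γ k) {τ : N.Edge → ℝ → ℝ}
    (hc : ∀ e, ContinuousOn (τ e) (Set.Ici 0)) (hm : ∀ e, MonotoneOn (τ e) (Set.Ici 0))
    {t : EuclideanSpace ℝ N.Edge} {x : N.PathFlow} (hx : N.IsGibbsFlow d γ t x)
    (ht : ∀ e, t e = τ e (N.flowVec x e)) : N.IsNestedSolution d γ τ x := by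
  have hfe := hx.isFeasible hd
  have hdom := mem_dualDomain_of_cost_eq hc hm hfe ht
  refine fun k => ⟨hfe k, fun y hy => ?_⟩
  rw [hx.nestedValue_eq hd hγ hc hm ht, hx.levelCost_add_nestedBound_eq hd hγ hc hm ht]
  exact (nestedBound_le_levelCost_add hγ hdom hy).trans (add_le_add_right
    (nestedBound_le_nestedValue hγ hdom _ fun w _ => N.edgeFlow_nonneg hy.1 w) _)

theorem IsNestedSolution.nestedValue_eq {d : V × V → ℝ} {γ : Fin N.m → ℝ}
    {τ : N.Edge → ℝ → ℝ} {x : N.PathFlow} (hx : N.IsNestedSolution d γ τ x) (k : Fin N.m) :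
    N.nestedValue γ τ k (N.demand d x k) =
      N.levelCost γ τ k (N.demand d x k) (x k) + N.nestedValue γ τ (k + 1) (N.edgeFlow (x k)) := by
  rw [N.nestedValue_of_lt]
  refine IsLeast.csInf_eq ⟨⟨x k, (hx k).1, rfl⟩, ?_⟩
  rintro _ ⟨y, hy, rfl⟩
  exact (hx k).2 y hy

/-- The value of a nested solution is the optimal value of the chain of nested problems. -/
theorem IsNestedSolution.primalObjective_eq {d : V × V → ℝ} {γ : Fin N.m → ℝ}
    {τ : N.Edge → ℝ → ℝ} {x : N.PathFlow} (hx : N.IsNestedSolution d γ τ x) :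
    N.primalObjective d γ τ x = N.nestedValue γ τ 0 d := by
  have h := N.sum_level_telescope
    (fun k => if h : k < N.m then N.nestedValue γ τ k (N.demand d x ⟨k, h⟩) else 0)
    (fun k => N.levelCost γ τ k (N.demand d x k) (x k)) (fun k => by
      rw [dif_pos k.2, hx.nestedValue_eq k]
      by_cases hk : (k : ℕ) + 1 < N.m
      · rw [dif_pos hk, demand_succ]
        ring
      · rw [dif_neg hk, N.nestedValue_of_le γ τ (not_lt.1 hk)]
        ring)
  rw [dif_pos N.m_pos, dif_neg (lt_irrefl _), sub_zero] at h
  exact h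

end MultilevelNetwork

-- Assembly of the theorem

theorem mainTheorem4 {V : Type*} [DecidableEq V] (N : MultilevelNetwork V)
    (d : V × V → ℝ) (hd : ∀ w ∈ N.OD 0, 0 < d w)
    (γ : Fin N.m → ℝ) (hγ : ∀ k, 0 < γ k)
    (τ : N.Edge → ℝ → ℝ) (hτ_cont : ∀ e, ContinuousOn (τ e) (Set.Ici 0))
    (hτ_mono : ∀ e, MonotoneOn (τ e) (Set.Ici 0)) (hτ_nonneg : ∀ e, 0 ≤ τ e 0) :
    -- strong duality, both extrema being attained
    (∃ v : ℝ, IsLeast (N.primalObjective d γ τ '' {x | N.IsFeasible d x}) v ∧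
      IsLeast (N.dualObjective d γ τ '' N.dualDomain τ) (-v)) ∧
    (∃ t : EuclideanSpace ℝ N.Edge, ∃ x : N.PathFlow,
      -- `t` is the unique dual solution, and `t ≥ 0`
      (∀ s, N.IsDualSolution d γ τ s ↔ s = t) ∧ (∀ e, 0 ≤ t e) ∧
      -- `x` is the unique solution of the primal problem, in its joint and in its nested form
      (∀ y, N.IsPrimalSolution d γ τ y ↔ y = x) ∧
      (∀ y, N.IsNestedSolution d γ τ y ↔ y = x) ∧
      -- recovery of the primal solution from `t`
      HasGradientAt (N.psi d γ) (-N.flowVec x) ((γ N.top)⁻¹ • t) ∧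
      (∀ y, N.IsGibbsFlow d γ t y ↔ y = x) ∧
      -- recovery of `t` from the primal solution
      (∀ e, t e = τ e (N.flowVec x e))) ∧
    -- if some of the parameters vanish, the edge costs are still determined uniquely
    (∀ γ' : Fin N.m → ℝ, (∀ k, 0 ≤ γ' k) →
      ∀ x y, N.IsPrimalSolution d γ' τ x → N.IsPrimalSolution d γ' τ y →
        ∀ e, τ e (N.flowVec x e) = τ e (N.flowVec y e)) := by
  -- Any costs would do here: this flow only shows that the feasible set is nonempty.
  obtain ⟨x₀, hx₀⟩ := N.exists_isGibbsFlow d γ 0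
  obtain ⟨x, hx⟩ := N.exists_isPrimalSolution γ hτ_cont ⟨x₀, hx₀.isFeasible hd⟩
  let t : EuclideanSpace ℝ N.Edge := WithLp.toLp 2 fun e => τ e (N.flowVec x e)
  have ht : ∀ e, t e = τ e (N.flowVec x e) := fun _ => rfl
  have hG : N.IsGibbsFlow d γ t x := hx.isGibbsFlow hd hγ hτ_cont hτ_mono ht
  have hdom : t ∈ N.dualDomain τ :=
    MultilevelNetwork.mem_dualDomain_of_cost_eq hτ_cont hτ_mono hx.1 ht
  have hstrong := MultilevelNetwork.strong_duality hd hγ hτ_cont hτ_mono hG ht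
  have htsol : N.IsDualSolution d γ τ t := ⟨hdom, fun s hs => by
    have := MultilevelNetwork.weak_duality hγ hs hx.1
    linarith⟩
  have hprimal : ∀ y, N.IsPrimalSolution d γ τ y → y = x := fun y hy =>
    (MultilevelNetwork.isGibbsFlow_and_cost_eq_of_duality hd hγ hτ_cont hτ_mono hdom hy.1
      ((hy.2 x hx.1).trans hstrong.le)).1.unique hG
  have hnested := hG.isNestedSolution hd hγ hτ_cont hτ_mono ht
  refine ⟨⟨N.primalObjective d γ τ x, ⟨⟨x, hx.1, rfl⟩, ?_⟩, ⟨⟨t, hdom, ?_⟩, ?_⟩⟩,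
    ⟨t, x, fun s => ⟨fun hs => ?_, ?_⟩, fun e => ?_, fun y => ⟨hprimal y, ?_⟩,
      fun y => ⟨fun hy => ?_, ?_⟩, hG.hasGradientAt_psi hd hγ,
      fun y => ⟨fun hy => hy.unique hG, ?_⟩, ht⟩, ?_⟩
  · rintro _ ⟨y, hy, rfl⟩
    exact hx.2 y hy
  · linarith
  · rintro _ ⟨s, hs, rfl⟩
    have := htsol.2 s hs
    linarith
  -- Another dual solution also has no gap to `x`, so it equals `τ(f)` as well.
  · have h := MultilevelNetwork.isGibbsFlow_and_cost_eq_of_duality hd hγ hτ_cont hτ_mono hs.1 hx.1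
      (hstrong.le.trans (neg_le_neg (hs.2 t hdom)))
    ext e
    rw [h.2 e, ht e]
  · rintro rfl
    exact htsol
  · exact (hτ_nonneg e).trans
      (hτ_mono e Set.self_mem_Ici (hx.1.flowVec_nonneg e) (hx.1.flowVec_nonneg e))
  · rintro rfl
    exact hx
  -- All nested solutions share the objective value `nestedValue γ τ 0 d`, and `x` is one of them;
  -- so `y` is a joint minimizer.
  · refine hprimal y ⟨fun k => (hy k).1, fun z hz => ?_⟩
    rw [hy.primalObjective_eq, ← hnested.primalObjective_eq]
    exact hx.2 z hz
  · rintro rfl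
    exact hnested
  · rintro rfl
    exact hG
  · exact fun γ' hγ' x y hx hy e => hx.cost_eq hγ' hτ_cont hτ_mono hy e
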